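/- Let $M$ be a nonzero $n\times n$ complex matrix, let $\nu$ be the largest size of a Jordan block of $M$ associated to the eigenvalue $0$ (with $\nu=0$ if $M$ is invertible), and let $\mathcal E(M)$ be the set of nonzero eigenvalues of $M$. If $\mathcal E(M)\neq\varnothing$, let $G(M)$ be the subgroup of $\mathbb C^*$ generated by $\mathcal E(M)$; write $G(M)_{\mathrm{tor}}$ for its torsion subgroup and $\operatorname{rk}G(M)$ for its rank as a finitely generated abelian group. Identify the space of $n\times n$ complex matrices with $\mathbb C^{n^2}$. An affine toric variety is a Zariski closed set that is isomorphic, as an affine variety, to the Zariski closure in some $\mathbb C^N$ of the image of a monomial map $(\mathbb C^*)^r\to(\mathbb C^*)^N$, $x\mapsto(x^{\alpha_1},\dots,x^{\alpha_N})$, with $\alpha_1,\dots,\alpha_N\in\mathbb Z^r$. Then the Zariski closure $\overline X$ in $\mathbb C^{n^2}$ of the semigroup $X=\{M^k\mid k\in\mathbb Z_{>0}\}$ can be written as a disjoint union $\overline X=X_0\,\dot\cup\,X_1$ of Zariski closed sets such that: 1. $X_0$ is a finite set of points, of cardinality $\nu$ if $\mathcal E(M)=\varnothing$, and of cardinality $\max\{0,\nu-1\}$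 otherwise. 2. If $\mathcal E(M)=\varnothing$, then $X_1=\varnothing$. If $\mathcal E(M)\neq\varnothing$, then $X_1$ is the union of $|G(M)_{\mathrm{tor}}|$ distinct affine toric varieties, each of dimension $\dim X_1$, where $$\dim X_1=\begin{cases}\operatorname{rk}G(M)&\text{if }M^{\max\{1,\nu\}}\text{ is diagonalizable},\\ \operatorname{rk}G(M)+1&\text{otherwise.}\end{cases}$$ -/

import Mathlib

open MvPolynomial

noncomputable section

namespace CyclicClosure

/-! ### Affine varieties over the complex numbers

Points of affine space are functions `σ → ℂ`, with `σ` a finite set of coordinates. -/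

/-- Zariski closed subsets of affine space: common zero sets of (an ideal of) polynomials. -/
def IsZariskiClosed {σ : Type*} (V : Set (σ → ℂ)) : Prop :=
  ∃ I : Ideal (MvPolynomial σ ℂ), V = zeroLocus ℂ I

/-- The Zariski closure: the common zeros of all polynomials that vanish on the set. -/
def zariskiClosure {σ : Type*} (S : Set (σ → ℂ)) : Set (σ → ℂ) :=
  zeroLocus ℂ (vanishingIdeal ℂ S)

/-- The coordinate ring `ℂ[σ] / I(V)`. -/
abbrev CoordinateRing {σ : Type*} (V : Set (σ → ℂ)) : Type _ :=
  MvPolynomial σ ℂ ⧸ vanishingIdeal ℂ V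

/-- The dimension of a variety: the Krull dimension of its coordinate ring
(it is `⊥` for the empty set). -/
def dimension {σ : Type*} (V : Set (σ → ℂ)) : WithBot ℕ∞ :=
  ringKrullDim (CoordinateRing V)

/-- The polynomial map `(σ → ℂ) → (τ → ℂ)` with components `f t`. -/
def polyMap {σ τ : Type*} (f : τ → MvPolynomial σ ℂ) (x : σ → ℂ) : τ → ℂ :=
  fun t => eval x (f t)

/-- Isomorphism of affine varieties: mutually inverse polynomial maps. -/
def AreIsomorphic {σ τ : Type*} (V : Set (σ → ℂ)) (W : Set (τ → ℂ)) : Prop :=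
  ∃ (f : τ → MvPolynomial σ ℂ) (g : σ → MvPolynomial τ ℂ),
    Set.MapsTo (polyMap f) V W ∧ Set.MapsTo (polyMap g) W V ∧
    Set.LeftInvOn (polyMap g) (polyMap f) V ∧ Set.LeftInvOn (polyMap f) (polyMap g) W

/-- The monomial map `(ℂ^*)^r → ℂ^N`, `x ↦ (x^{α_1}, …, x^{α_N})`, of a family of
lattice points `α_1, …, α_N` in `ℤ^r`. -/
def monomialMap {N r : ℕ} (α : Fin N → Fin r → ℤ) (x : Fin r → ℂˣ) : Fin N → ℂ :=
  fun i => ∏ j, (x j : ℂ) ^ α i j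

/-- The affine toric variety `Y_α` in `ℂ^N`: the Zariski closure of the image of the
monomial map. -/
def latticeToricVariety {N r : ℕ} (α : Fin N → Fin r → ℤ) : Set (Fin N → ℂ) :=
  zariskiClosure (Set.range (monomialMap α))

/-- An affine toric variety: a Zariski closed set that is isomorphic, as an affine variety,
to `Y_α` for some finite family `α` of lattice points. -/
def IsToricVariety {σ : Type*} (V : Set (σ → ℂ)) : Prop :=
  IsZariskiClosed V ∧
    ∃ (N r : ℕ) (α : Fin N → Fin r → ℤ), AreIsomorphic V (latticeToricVariety α)

/-! ### Matrices -/

/-- The identification of `n × n` matrices with affine space of dimension `n^2`. -/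
def entries {n : ℕ} (A : Matrix (Fin n) (Fin n) ℂ) : Fin n × Fin n → ℂ :=
  fun p => A p.1 p.2

/-- The semigroup `{M^k | k > 0}`, as a subset of affine space of dimension `n^2`. -/
def semigroupSet {n : ℕ} (M : Matrix (Fin n) (Fin n) ℂ) : Set (Fin n × Fin n → ℂ) :=
  {x | ∃ k : ℕ, 0 < k ∧ x = entries (M ^ k)}

/-- The set of nonzero eigenvalues of `M`. -/
def nonzeroEigenvalues {n : ℕ} (M : Matrix (Fin n) (Fin n) ℂ) : Set ℂˣ :=
  {u | Module.End.HasEigenvalue (Matrix.toLin' M) (u : ℂ)}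

/-- The multiplicative group `G(M)` generated by the nonzero eigenvalues of `M`. -/
def eigenvalueGroup {n : ℕ} (M : Matrix (Fin n) (Fin n) ℂ) : Subgroup ℂˣ :=
  Subgroup.closure (nonzeroEigenvalues M)

/-- The order of the torsion subgroup of `G(M)`. -/
def torsionOrder {n : ℕ} (M : Matrix (Fin n) (Fin n) ℂ) : ℕ :=
  Nat.card (CommGroup.torsion (eigenvalueGroup M))

/-- The rank of the finitely generated abelian group `G(M)`. -/
def groupRank {n : ℕ} (M : Matrix (Fin n) (Fin n) ℂ) : ℕ :=
  Module.finrank ℤ (Additive (eigenvalueGroup M))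

/-- `A = P D P⁻¹` with `D` diagonal. -/
def IsDiagonalizable {n : ℕ} (A : Matrix (Fin n) (Fin n) ℂ) : Prop :=
  ∃ (P : GL (Fin n) ℂ) (d : Fin n → ℂ),
    A = (P : Matrix (Fin n) (Fin n) ℂ) * Matrix.diagonal d *
      ((P⁻¹ : GL (Fin n) ℂ) : Matrix (Fin n) (Fin n) ℂ)

/-- The `m × m` Jordan block with eigenvalue `c` and ones above the diagonal. -/
def jordanBlock (m : ℕ) (c : ℂ) : Matrix (Fin m) (Fin m) ℂ :=
  Matrix.of fun i j => if i = j then c else if (i : ℕ) + 1 = (j : ℕ) then 1 else 0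

/-- A Jordan normal form of `M`: nonempty Jordan blocks whose direct sum is similar to `M`. -/
structure JordanForm {n : ℕ} (M : Matrix (Fin n) (Fin n) ℂ) where
  /-- number of blocks -/
  numBlocks : ℕ
  /-- sizes of the blocks -/
  size : Fin numBlocks → ℕ
  size_pos : ∀ i, 0 < size i
  /-- eigenvalues of the blocks -/
  eigenvalue : Fin numBlocks → ℂ
  /-- the numbering of the rows of the block diagonal matrix -/
  index : (Σ i, Fin (size i)) ≃ Fin n
  /-- the change of basis -/
  P : GL (Fin n) ℂ
  eq_conj : M = (P : Matrix (Fin n) (Fin n) ℂ) *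
    Matrix.reindex index index
      (Matrix.blockDiagonal' fun i => jordanBlock (size i) (eigenvalue i)) *
    ((P⁻¹ : GL (Fin n) ℂ) : Matrix (Fin n) (Fin n) ℂ)

/-- The sizes of the Jordan blocks of `M` associated to the eigenvalue `0`. -/
def zeroBlockSizes {n : ℕ} (M : Matrix (Fin n) (Fin n) ℂ) : Set ℕ :=
  {m | ∃ (J : JordanForm M) (i : Fin J.numBlocks), J.eigenvalue i = 0 ∧ J.size i = m}

theorem bddAbove_zeroBlockSizes {n : ℕ} (M : Matrix (Fin n) (Fin n) ℂ) :
    BddAbove (zeroBlockSizes M) := by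
  refine ⟨n, ?_⟩
  rintro m ⟨J, i, -, rfl⟩
  simpa using Fintype.card_le_of_injective (fun j : Fin (J.size i) => J.index ⟨i, j⟩)
    (fun a b h => by simpa using h)

/-- The largest size of a Jordan block of `M` associated to `0`
(it is `0` if there is no such block, that is, if `M` is invertible). -/
def nu {n : ℕ} (M : Matrix (Fin n) (Fin n) ℂ) : ℕ :=
  sSup (zeroBlockSizes M)

open Classical in
/-- `rk G(M)` if `M ^ max {1, ν}` is diagonalizable, and `rk G(M) + 1` otherwise. -/
def expectedDim {n : ℕ} (M : Matrix (Fin n) (Fin n) ℂ) : ℕ :=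
  if IsDiagonalizable (M ^ max 1 (nu M)) then groupRank M else groupRank M + 1

end CyclicClosure

end

/-!
Write `q = max 1 ν`, `t = |G(M)_tor|`, and let `S` be the set of nonzero eigenvalues of `M`.

*The entries of the powers.* The largest Jordan block at `0` has the size of the multiplicity of
the root `0` in the minimal polynomial (`nu_eq_rootMultiplicity`). For `k ≥ q`, the entries of
`M ^ k` therefore satisfy the linear recurrence with characteristic polynomial `minpoly / X ^ ν`,
and they span its space of solutions, because no polynomial of smaller degree works. That space
has the basis `c ^ k * k ^ j`, for `c ∈ S` and `j` less than the multiplicity of `c` in the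
minimal polynomial. Hence the entries of `M ^ k` and the numbers `c ^ k * k ^ j` are linear
combinations of each other, with coefficients independent of `k` (`exists_linear_relations`).
Exponents `j > 0` occur if and only if `M ^ q` is not diagonalizable (`isDiagonalizable_pow_iff`).

*Residue classes.* Let `g₁, …, g_r ∈ G(M)` represent a basis of `G(M)` modulo torsion. Each
`c ∈ S` is a Laurent monomial in the `g_j` times a `t`-th root of unity, and the exponent vectors
of these monomials generate `ℤ ^ r` (`exists_free_coordinates`). For `k` in a fixed residue class
modulo `t`, the roots of unity contribute constants, so that `M ^ k` is, up to a linear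
isomorphism, the vector of a family of Laurent monomials at the point `(g₁ ^ k, …, g_r ^ k)`,
respectively `(g₁ ^ k, …, g_r ^ k, k)` if `M ^ q` is not diagonalizable, of the torus. These
points are Zariski dense in the torus even if `k` runs through a single residue class, because
nonzero sequences `c ^ k * p(k)`, with polynomials `p` and distinct `c ≠ 0`, are linearly
independent (`laurent_eq_zero`). So the closure `Y_c` of the residue class `c` is a toric variety
(`dimension_and_isToricVariety_powersMod`), whose coordinate ring is generated by Laurent
monomials. Their exponents generate the lattice `ℤ ^ r`, respectively `ℤ ^ (r + 1)`, because
`c ^ k * k` and `c ^ k` differ by the factor `k`; so the Krull dimension, which by Noether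
normalization is the transcendence degree, is `r`, respectively `r + 1`
(`ringKrullDim_monomialSubalgebra`). The `Y_c` are distinct since `G(M)` contains a root of unity
`ζ` of order `t`, and `ζ ^ k` is a rational function of the entries of `M ^ k`
(`injective_zariskiClosure_powersMod`).

*The small powers.* There is a matrix `N` with `M ^ ν * N = 0` and, if `ν > 0`,
`M ^ (ν - 1) * N ≠ 0`, so the linear equation `A * N = 0` separates `M ^ k`, for `k < ν`, from the
closure of the higher powers (`entries_pow_notMem_zariskiClosure`). The isolated points are thus
the `M ^ k` with `1 ≤ k < ν`, together with `M ^ ν = 0` if `S` is empty.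
-/

namespace CyclicClosure

/-! ### Krull dimension and transcendence degree -/

/-- Lying over and going up lift chains of primes, incomparability contracts them strictly. -/
theorem ringKrullDim_eq_of_isIntegral (R S : Type*) [CommRing R] [CommRing S] [Algebra R S]
    [Algebra.IsIntegral R S] (hinj : Function.Injective (algebraMap R S)) :
    ringKrullDim S = ringKrullDim R := by
  apply le_antisymm
  · refine Order.krullDim_le_of_strictMono (PrimeSpectrum.comap (algebraMap R S)) ?_
    intro P Q hPQ
    exact Ideal.IsIntegral.comap_lt_comap (R := R) (I := P.asIdeal) (J := Q.asIdeal) hPQ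
  · refine iSup_le fun l => ?_
    obtain ⟨P, -, hP, hPl⟩ := Ideal.exists_ideal_over_prime_of_isIntegral (S := S)
      (RelSeries.head l).asIdeal ⊥ (by
        rw [← RingHom.ker_eq_comap_bot, (RingHom.injective_iff_ker_eq_bot _).1 hinj]; exact bot_le)
    have : P.LiesOver (RelSeries.head l).asIdeal := ⟨hPl.symm⟩
    obtain ⟨L, hL, -⟩ := Ideal.exists_ltSeries_of_hasGoingUp l P
    rw [← hL]
    exact Order.LTSeries.length_le_krullDim L

/-- For finitely generated domains over a field, Krull dimension is transcendence degree: both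
are the number of variables in a Noether normalization. -/
theorem ringKrullDim_eq_of_trdeg_eq (k : Type*) {A : Type*} [Field k] [CommRing A] [IsDomain A]
    [Algebra k A] [Algebra.FiniteType k A] {d : ℕ} (hd : Algebra.trdeg k A = d) :
    ringKrullDim A = d := by
  obtain ⟨s, g, hg, hint⟩ := exists_integral_inj_algHom_of_fg k A
  let : Algebra (MvPolynomial (Fin s) k) A := g.toRingHom.toAlgebra
  have hst : IsScalarTower k (MvPolynomial (Fin s) k) A :=
    IsScalarTower.of_algebraMap_eq fun x => (g.commutes x).symm
  have : Algebra.IsIntegral (MvPolynomial (Fin s) k) A := ⟨hint⟩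
  have hinj : Function.Injective (algebraMap (MvPolynomial (Fin s) k) A) := hg
  have : FaithfulSMul (MvPolynomial (Fin s) k) A :=
    (faithfulSMul_iff_algebraMap_injective _ _).2 hinj
  have h1 := lift_trdeg_add_eq k (MvPolynomial (Fin s) k) A
  have h2 : Algebra.trdeg (MvPolynomial (Fin s) k) A = 0 := trdeg_eq_zero
  rw [h2, hd, MvPolynomial.trdeg_of_isDomain] at h1
  have h3 : s = d := by simpa using h1
  subst h3
  rw [ringKrullDim_eq_of_isIntegral _ _ hinj]
  simp

/-- A prime containing a finite intersection of ideals contains one of them, so that the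
dimension of a finite union of closed sets is the largest dimension of a member. -/
theorem ringKrullDim_quotient_iInf {R ι : Type*} [CommRing R] [Fintype ι] [Nonempty ι]
    (I : ι → Ideal R) {d : WithBot ℕ∞} (h : ∀ i, ringKrullDim (R ⧸ I i) = d) :
    ringKrullDim (R ⧸ ⨅ i, I i) = d := by
  apply le_antisymm
  · rw [ringKrullDim_quotient]
    refine iSup_le fun l => ?_
    have hl : (⨅ i, I i) ≤ (RelSeries.head l).1.asIdeal := (RelSeries.head l).2
    obtain ⟨i, -, hi⟩ := (Ideal.IsPrime.inf_le' (s := Finset.univ) inferInstance).1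
      ((Finset.inf_univ_eq_iInf I).le.trans hl)
    refine le_trans ?_ (h i).le
    rw [ringKrullDim_quotient]
    let L : LTSeries (PrimeSpectrum.zeroLocus (I i : Set R)) :=
      { length := l.length
        toFun := fun j => ⟨(l j).1, hi.trans (l.head_le j)⟩
        step := fun j => l.step j }
    exact Order.LTSeries.length_le_krullDim L
  · obtain ⟨i⟩ := ‹Nonempty ι›
    rw [← h i]
    exact ringKrullDim_le_of_surjective (Ideal.Quotient.factor (iInf_le I i))
      (Ideal.Quotient.factor_surjective _)

/-! ### Rings of Laurent monomials -/

/-- The ring of Laurent polynomials in variables `κ`, as the group algebra of `ℤ^κ`. -/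
abbrev Laurent (κ : Type) : Type := AddMonoidAlgebra ℂ (κ → ℤ)

/-- The Laurent monomial with exponent `b`. -/
noncomputable abbrev laurentMonomial {κ : Type} (b : κ → ℤ) : Laurent κ :=
  AddMonoidAlgebra.single b 1

/-- The subalgebra generated by Laurent monomials. -/
noncomputable abbrev monomialSubalgebra {κ : Type} {I : Type*} (α : I → κ → ℤ) :
    Subalgebra ℂ (Laurent κ) :=
  Algebra.adjoin ℂ (Set.range fun i => laurentMonomial (α i))

/-- The exponents of the monomials that are algebraic over the subalgebra form a subgroup. -/
theorem isAlgebraic_monomialSubalgebra {κ : Type} {I : Type*} (α : I → κ → ℤ)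
    (hα : AddSubgroup.closure (Set.range α) = ⊤) :
    Algebra.IsAlgebraic (monomialSubalgebra α) (Laurent κ) := by
  have key : ∀ b : κ → ℤ, IsAlgebraic (monomialSubalgebra α) (laurentMonomial b) := by
    intro b
    have hb : b ∈ AddSubgroup.closure (Set.range α) := by rw [hα]; trivial
    induction hb using AddSubgroup.closure_induction with
    | mem x hx =>
      obtain ⟨i, rfl⟩ := hx
      exact isAlgebraic_algebraMap (A := Laurent κ)
        (⟨laurentMonomial (α i), Algebra.subset_adjoin ⟨i, rfl⟩⟩ : monomialSubalgebra α)
    | zero => exact isAlgebraic_one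
    | add x y _ _ hx hy =>
      have : laurentMonomial (x + y) = laurentMonomial x * laurentMonomial y := by
        simp [AddMonoidAlgebra.single_mul_single]
      rw [this]; exact hx.mul hy
    | neg x _ hx =>
      let : Invertible (laurentMonomial x) := ⟨laurentMonomial (-x),
        by simp [AddMonoidAlgebra.single_mul_single, AddMonoidAlgebra.one_def],
        by simp [AddMonoidAlgebra.single_mul_single, AddMonoidAlgebra.one_def]⟩
      exact hx.invOf
  refine ⟨fun x => ?_⟩
  induction x using AddMonoidAlgebra.induction_linear with
  | zero => exact isAlgebraic_zero
  | add f g hf hg => exact hf.add hg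
  | single b c =>
    have : (AddMonoidAlgebra.single b c : Laurent κ) =
        algebraMap (monomialSubalgebra α) (Laurent κ) (algebraMap ℂ _ c) * laurentMonomial b := by
      rw [← IsScalarTower.algebraMap_apply]
      simp [AddMonoidAlgebra.single_mul_single]
    rw [this]
    exact (isAlgebraic_algebraMap _).mul (key b)

theorem algebraicIndependent_laurentMonomial {κ : Type} [Fintype κ] [DecidableEq κ] :
    AlgebraicIndependent ℂ fun j : κ => laurentMonomial (Pi.single j (1 : ℤ)) := by
  rw [algebraicIndependent_iff]
  intro F hF
  have hmon : ∀ m : κ →₀ ℕ, (∏ j, laurentMonomial (Pi.single j (1 : ℤ)) ^ m j : Laurent κ)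
      = laurentMonomial (fun j => (m j : ℤ)) := by
    intro m
    simp only [AddMonoidAlgebra.single_pow, one_pow]
    rw [AddMonoidAlgebra.prod_single]
    congr 1
    · ext j
      simp [Finset.sum_apply, Pi.single_apply]
    · simp
  ext m
  rw [aeval_def, eval₂_eq'] at hF
  simp only [hmon] at hF
  have h := congrArg (fun x : Laurent κ => x.coeff (fun j => (m j : ℤ))) hF
  have hinj : ∀ m' : κ →₀ ℕ, ((fun j => (m' j : ℤ)) = fun j => (m j : ℤ)) ↔ m' = m := by
    intro m'
    simp [funext_iff, Finsupp.ext_iff]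
  simpa [AddMonoidAlgebra.coeff_sum, AddMonoidAlgebra.single_mul_single, Finsupp.single_apply,
    Finsupp.finsetSum_apply, hinj] using h

theorem trdeg_laurent {κ : Type} [Fintype κ] : Algebra.trdeg ℂ (Laurent κ) = Fintype.card κ := by
  classical
  have halg := isAlgebraic_monomialSubalgebra (fun j : κ => (Pi.single j (1 : ℤ) : κ → ℤ)) (by
    rw [eq_top_iff]
    intro b _
    rw [← Finset.univ_sum_single b]
    refine AddSubgroup.sum_mem _ fun j _ => ?_
    have : (Pi.single j (b j) : κ → ℤ) = b j • Pi.single j 1 := by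
      rw [← Pi.single_smul]; simp
    rw [this]
    exact AddSubgroup.zsmul_mem _ (AddSubgroup.subset_closure (Set.mem_range_self j)) _)
  have hb := (algebraicIndependent_laurentMonomial (κ := κ)).isTranscendenceBasis_iff_isAlgebraic.2
    halg
  rw [← hb.cardinalMk_eq_trdeg]; simp

/-- If the exponents generate `ℤ^κ`, then the algebra generated by the Laurent monomials has
dimension `|κ|`, since all Laurent polynomials are algebraic over it. -/
theorem ringKrullDim_monomialSubalgebra {κ : Type} [Fintype κ] {I : Type*} [Finite I]
    (α : I → κ → ℤ) (hα : AddSubgroup.closure (Set.range α) = ⊤) :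
    ringKrullDim (monomialSubalgebra α) = Fintype.card κ := by
  have := isAlgebraic_monomialSubalgebra α hα
  have hfg : Algebra.FiniteType ℂ (monomialSubalgebra α) :=
    (Subalgebra.fg_iff_finiteType _).1
      ⟨(Set.finite_range fun i => laurentMonomial (α i)).toFinset, by simp⟩
  apply ringKrullDim_eq_of_trdeg_eq ℂ
  have hf : FaithfulSMul ℂ (monomialSubalgebra α) :=
    (faithfulSMul_iff_algebraMap_injective _ _).2 (algebraMap ℂ (monomialSubalgebra α)).injective
  have h1 := trdeg_add_eq ℂ (monomialSubalgebra α) (A := Laurent κ)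
  rw [trdeg_eq_zero (R := monomialSubalgebra α), add_zero, trdeg_laurent] at h1
  exact_mod_cast h1

/-! ### Existence of the Jordan normal form -/

/-- The basis consists of the powers `(X - c) ^ (m - 1 - j)`. -/
theorem exists_basis_quotient_pow (f : Polynomial ℂ) (c : ℂ) (m : ℕ)
    (hf : Associated f ((Polynomial.X - Polynomial.C c) ^ m)) :
    ∃ b : Module.Basis (Fin m) ℂ (Polynomial ℂ ⧸ Ideal.span {f}), ∀ j : Fin m,
      (Polynomial.X - Polynomial.C c) • b j =
        if h : 0 < (j : ℕ) then b ⟨j - 1, by omega⟩ else 0 := by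
  set y : Polynomial ℂ := Polynomial.X - Polynomial.C c with hy
  have hfdvd : ∀ r, Ideal.Quotient.mk (Ideal.span {f}) r = 0 ↔ y ^ m ∣ r := by
    intro r
    rw [Ideal.Quotient.eq_zero_iff_mem, Ideal.mem_span_singleton, hf.dvd_iff_dvd_left]
  let v : Fin m → Polynomial ℂ ⧸ Ideal.span {f} :=
    fun j => Ideal.Quotient.mk _ (y ^ (m - 1 - (j : ℕ)))
  have hli : LinearIndependent ℂ v := by
    rw [Fintype.linearIndependent_iff]
    intro g hg j
    have h1 : Ideal.Quotient.mk (Ideal.span {f})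
        (∑ i : Fin m, Polynomial.C (g i) * y ^ (m - 1 - (i : ℕ))) = 0 := by
      rw [← hg, map_sum]
      refine Finset.sum_congr rfl fun i _ => ?_
      rw [← Polynomial.smul_eq_C_mul]
      rfl
    rw [hfdvd, Polynomial.X_sub_C_pow_dvd_iff, Polynomial.X_pow_dvd_iff] at h1
    have h2 := h1 (m - 1 - (j : ℕ)) (by omega)
    simp only [Polynomial.sum_comp, Polynomial.mul_comp, Polynomial.C_comp,
      Polynomial.pow_comp, hy, Polynomial.sub_comp, Polynomial.X_comp, add_sub_cancel_right,
      Polynomial.finsetSum_coeff, Polynomial.coeff_C_mul, Polynomial.coeff_X_pow] at h2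
    rw [Finset.sum_eq_single j] at h2
    · simpa using h2
    · intro i _ hij
      rw [if_neg, mul_zero]
      intro h
      apply hij
      ext
      omega
    · simp
  have hcard : Fintype.card (Fin m) = Module.finrank ℂ (Polynomial ℂ ⧸ Ideal.span {f}) := by
    rw [finrank_quotient_span_eq_natDegree, Polynomial.natDegree_eq_of_degree_eq
      (Polynomial.degree_eq_degree_of_associated hf)]
    simp [hy]
  rcases Nat.eq_zero_or_pos m with rfl | hm
  · have : Module.finrank ℂ (Polynomial ℂ ⧸ Ideal.span {f}) = 0 := by simpa using hcard.symm
    have hunit : Subsingleton (Polynomial ℂ ⧸ Ideal.span {f}) := by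
      rw [Ideal.Quotient.subsingleton_iff, Ideal.span_singleton_eq_top]
      simpa using hf.isUnit_iff
    exact ⟨Module.Basis.empty _, fun j => j.elim0⟩
  have : Nonempty (Fin m) := ⟨⟨0, hm⟩⟩
  refine ⟨basisOfLinearIndependentOfCardEqFinrank hli hcard, fun j => ?_⟩
  simp only [coe_basisOfLinearIndependentOfCardEqFinrank, v]
  have hsm : y • Ideal.Quotient.mk (Ideal.span {f}) (y ^ (m - 1 - (j : ℕ))) =
      Ideal.Quotient.mk (Ideal.span {f}) (y ^ (m - 1 - (j : ℕ) + 1)) := by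
    rw [pow_succ']; rfl
  rw [hsm]
  split_ifs with h
  · congr 2; omega
  · rw [hfdvd]
    exact pow_dvd_pow _ (by omega)

/-- A Jordan basis: the module over `ℂ[X]` defined by `φ` is a direct sum of modules
`ℂ[X] / (X - c) ^ m`, in which the powers of `X - c` form a chain. -/
theorem exists_jordan_basis {V : Type} [AddCommGroup V] [Module ℂ V] [FiniteDimensional ℂ V]
    (φ : Module.End ℂ V) :
    ∃ (ι : Type) (_ : Fintype ι) (c : ι → ℂ) (m : ι → ℕ)
      (b : Module.Basis (Σ i, Fin (m i)) ℂ V), ∀ i (j : Fin (m i)),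
      φ (b ⟨i, j⟩) = c i • b ⟨i, j⟩ +
        if h : 0 < (j : ℕ) then b ⟨i, ⟨j - 1, by omega⟩⟩ else 0 := by
  classical
  obtain ⟨ι, hι, p, hp, e, ⟨l⟩⟩ := Module.equiv_directSum_of_isTorsion
    (R := Polynomial ℂ) (M := Module.AEval' φ)
    (Module.AEval.isTorsion_of_finiteDimensional ℂ V φ)
  have hc : ∀ i, ∃ c, Associated (p i) (Polynomial.X - Polynomial.C c) := by
    intro i
    obtain ⟨c, hc⟩ := IsAlgClosed.exists_root (p i)
      (by rw [IsAlgClosed.degree_eq_one_of_irreducible ℂ (hp i)]; exact one_ne_zero)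
    refine ⟨c, ((Polynomial.irreducible_X_sub_C c).associated_of_dvd (hp i)
      (Polynomial.dvd_iff_isRoot.2 hc)).symm⟩
  choose c hc using hc
  choose β hβ using fun i => exists_basis_quotient_pow (p i ^ e i) (c i) (e i) ((hc i).pow_pow)
  let B : Module.Basis (Σ i, Fin (e i)) ℂ
      (DirectSum ι fun i => Polynomial ℂ ⧸ Ideal.span {p i ^ e i}) :=
    DFinsupp.basis β
  have hB : ∀ i j, B ⟨i, j⟩ = DirectSum.lof (Polynomial ℂ) ι
      (fun i => Polynomial ℂ ⧸ Ideal.span {p i ^ e i}) i (β i j) := by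
    intro i j
    rw [← B.repr.injective.eq_iff, B.repr_self]
    change _ = (sigmaFinsuppLequivDFinsupp ℂ).symm (DFinsupp.mapRange.linearEquiv
      (fun i => (β i).repr) (DFinsupp.single i (β i j)))
    ext ⟨i', j'⟩
    by_cases h : i = i'
    · subst h
      simp [Finsupp.single_apply]
    · simp [h]
  let L : V ≃ₗ[ℂ] DirectSum ι fun i => Polynomial ℂ ⧸ Ideal.span {p i ^ e i} :=
    (Module.AEval'.of φ).trans (l.restrictScalars ℂ)
  have hL : ∀ x, L.symm ((Polynomial.X : Polynomial ℂ) • x) = φ (L.symm x) := by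
    intro x
    rw [LinearEquiv.symm_apply_eq]
    obtain ⟨v, rfl⟩ := L.surjective x
    rw [LinearEquiv.symm_apply_apply]
    change _ • l (Module.AEval'.of φ v) = l (Module.AEval'.of φ (φ v))
    rw [← map_smul, Module.AEval'.X_smul_of]
  -- the inclusion of the summand with index `i`, transported to `V`
  let T : ∀ i, (Polynomial ℂ ⧸ Ideal.span {p i ^ e i}) →ₗ[ℂ] V := fun i =>
    L.symm.toLinearMap.comp ((DirectSum.lof (Polynomial ℂ) ι
      (fun i => Polynomial ℂ ⧸ Ideal.span {p i ^ e i}) i).restrictScalars ℂ)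
  have hT : ∀ i x, φ (T i x) = T i ((Polynomial.X : Polynomial ℂ) • x) := by
    intro i x
    simp only [T, LinearMap.comp_apply, LinearEquiv.coe_coe, LinearMap.restrictScalars_apply,
      map_smul, hL]
  have hTB : ∀ i j, B.map L.symm ⟨i, j⟩ = T i (β i j) := by
    intro i j
    simp only [Module.Basis.map_apply, hB]
    rfl
  refine ⟨ι, hι, c, e, B.map L.symm, fun i j => ?_⟩
  have h1 : (Polynomial.X : Polynomial ℂ) • β i j = c i • β i j +
      if h : 0 < (j : ℕ) then β i ⟨j - 1, by omega⟩ else 0 := by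
    rw [← hβ i j, sub_smul]
    have : (Polynomial.C (c i)) • β i j = c i • β i j := by
      rw [← Polynomial.algebraMap_eq, algebraMap_smul]
    rw [this]; abel
  simp only [hTB]
  rw [hT, h1, map_add, map_smul]
  split_ifs with h
  · rfl
  · rw [map_zero]

theorem exists_jordanForm {n : ℕ} (M : Matrix (Fin n) (Fin n) ℂ) : Nonempty (JordanForm M) := by
  classical
  obtain ⟨ι, _, c, m, b, hb⟩ := exists_jordan_basis (Matrix.toLin' M)
  -- blocks of size zero are dropped
  let eS : {i // 0 < m i} ≃ Fin (Fintype.card {i // 0 < m i}) := Fintype.equivFin _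
  let σ : (Σ k, Fin (m (eS.symm k).1)) ≃ Σ i, Fin (m i) :=
    Equiv.ofBijective (fun x => ⟨(eS.symm x.1).1, x.2⟩) (by
      constructor
      · rintro ⟨k, j⟩ ⟨k', j'⟩ h
        simp only [Sigma.mk.injEq] at h
        obtain rfl : k = k' := eS.symm.injective (Subtype.ext h.1)
        simpa using h
      · rintro ⟨i, j⟩
        have hi : 0 < m i := j.pos
        refine ⟨⟨eS ⟨i, hi⟩, ⟨j, by simp⟩⟩, ?_⟩
        refine Sigma.ext (by simp) ?_
        simp [Fin.heq_ext_iff])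
  let b₂ := b.reindex σ.symm
  let idx := b₂.indexEquiv (Pi.basisFun ℂ (Fin n))
  let b₃ := b₂.reindex idx
  let P : GL (Fin n) ℂ := ⟨(Pi.basisFun ℂ (Fin n)).toMatrix b₃, b₃.toMatrix (Pi.basisFun ℂ (Fin n)),
    Module.Basis.toMatrix_mul_toMatrix_flip _ _, Module.Basis.toMatrix_mul_toMatrix_flip _ _⟩
  have hP : ∀ i k, (P : Matrix (Fin n) (Fin n) ℂ) i k = b₃ k i := fun i k => rfl
  refine ⟨⟨Fintype.card {i // 0 < m i}, fun k => m (eS.symm k).1, fun k => (eS.symm k).2,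
    fun k => c (eS.symm k).1, idx, P, ?_⟩⟩
  suffices h : M * (P : Matrix (Fin n) (Fin n) ℂ) = (P : Matrix (Fin n) (Fin n) ℂ) *
      Matrix.reindex idx idx (Matrix.blockDiagonal' fun k =>
        jordanBlock (m (eS.symm k).1) (c (eS.symm k).1)) by
    rw [← h, mul_assoc, Units.mul_inv, mul_one]
  ext i k
  obtain ⟨⟨k, j⟩, rfl⟩ := idx.surjective k
  have hb₂ : ∀ k j, b₂ ⟨k, j⟩ = b ⟨(eS.symm k).1, j⟩ := fun k j => by
    simp only [b₂, Module.Basis.reindex_apply, Equiv.symm_symm]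
    rfl
  have hb₃ : ∀ x, b₃ (idx x) = b₂ x := fun x => by simp [b₃]
  have h1 : (M * (P : Matrix (Fin n) (Fin n) ℂ)) i (idx ⟨k, j⟩) =
      Matrix.toLin' M (b ⟨(eS.symm k).1, j⟩) i := by
    rw [Matrix.toLin'_apply, Matrix.mul_apply, ← hb₂, ← hb₃]
    rfl
  rw [h1, hb, Matrix.mul_apply, ← idx.sum_comp, Fintype.sum_sigma, Finset.sum_eq_single k]
  · simp only [hP, hb₃, hb₂, Matrix.reindex_apply, Matrix.submatrix_apply,
      Equiv.symm_apply_apply, Matrix.blockDiagonal'_apply_eq, jordanBlock, Matrix.of_apply]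
    have hsplit : ∀ x : Fin (m (eS.symm k).1),
        (if x = j then c (eS.symm k).1 else if (x : ℕ) + 1 = j then 1 else 0 : ℂ) =
        (if x = j then c (eS.symm k).1 else 0) + (if (x : ℕ) + 1 = j then 1 else 0) := by
      intro x
      by_cases hx : x = j
      · subst hx; simp
      · simp [hx]
    simp only [hsplit, mul_add, Finset.sum_add_distrib]
    simp only [mul_ite, mul_zero, mul_one, Finset.sum_ite_eq', Finset.mem_univ, if_true,
      Pi.add_apply, Pi.smul_apply, smul_eq_mul, mul_comm (c _)]
    congr 1
    split_ifs with hj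
    · rw [Finset.sum_eq_single ⟨j - 1, by omega⟩]
      · rw [if_pos]
        simp only
        omega
      · intro x _ hx
        rw [if_neg]
        intro h
        apply hx
        ext
        simp only
        omega
      · simp
    · rw [Finset.sum_eq_zero]
      · rfl
      · intro x _
        rw [if_neg (by omega)]
  · intro k' _ hk'
    apply Finset.sum_eq_zero
    intro x _
    rw [Matrix.reindex_apply, Matrix.submatrix_apply, Equiv.symm_apply_apply,
      Equiv.symm_apply_apply, Matrix.blockDiagonal'_apply_ne _ _ _ hk', mul_zero]
  · simp

/-! ### The annihilating polynomials of a Jordan form -/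

theorem jordanBlock_zero_pow (m k : ℕ) :
    jordanBlock m 0 ^ k = Matrix.of fun i j : Fin m => if (i : ℕ) + k = j then (1 : ℂ) else 0 := by
  induction k with
  | zero => ext i j; simp [Matrix.one_apply, Fin.ext_iff]
  | succ k ih =>
    rw [pow_succ, ih]
    ext i j
    simp only [Matrix.mul_apply, jordanBlock, Matrix.of_apply]
    by_cases h : (i : ℕ) + (k + 1) = j
    · rw [if_pos h, Finset.sum_eq_single ⟨i + k, by omega⟩]
      · rw [if_pos rfl, if_neg, if_pos] <;> simp [Fin.ext_iff] <;> omega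
      · intro x _ hx
        rw [if_neg, zero_mul]
        intro h'
        exact hx (Fin.ext h'.symm)
      · simp
    · rw [if_neg h]
      apply Finset.sum_eq_zero
      intro x _
      by_cases hx : (i : ℕ) + k = x
      · rw [if_neg (show ¬ (x : ℕ) + 1 = j by omega)]
        simp
      · simp [hx]

theorem jordanBlock_eq (m : ℕ) (c : ℂ) :
    jordanBlock m c = jordanBlock m 0 + algebraMap ℂ (Matrix (Fin m) (Fin m) ℂ) c := by
  ext i j
  simp only [jordanBlock, Matrix.of_apply, Matrix.add_apply, Matrix.algebraMap_matrix_apply]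
  split_ifs <;> simp

theorem aeval_jordanBlock_eq_zero_iff (m : ℕ) (c : ℂ) (q : Polynomial ℂ) :
    Polynomial.aeval (jordanBlock m c) q = 0 ↔
      (Polynomial.X - Polynomial.C c) ^ m ∣ q := by
  rw [Polynomial.X_sub_C_pow_dvd_iff, Polynomial.X_pow_dvd_iff]
  have h1 : Polynomial.aeval (jordanBlock m c) q =
      Polynomial.aeval (jordanBlock m 0) (q.comp (Polynomial.X + Polynomial.C c)) := by
    rw [Polynomial.aeval_comp, jordanBlock_eq m c]
    simp
  rw [h1]
  generalize q.comp (Polynomial.X + Polynomial.C c) = r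
  have h2 : ∀ i j : Fin m, Polynomial.aeval (jordanBlock m 0) r i j =
      if (i : ℕ) ≤ j then r.coeff (j - i) else 0 := by
    intro i j
    rw [Polynomial.aeval_eq_sum_range, Matrix.sum_apply]
    simp only [jordanBlock_zero_pow, Matrix.smul_apply, Matrix.of_apply, smul_eq_mul, mul_ite,
      mul_one, mul_zero]
    split_ifs with h
    · by_cases hd : (j : ℕ) - i < r.natDegree + 1
      · rw [Finset.sum_eq_single ((j : ℕ) - i)]
        · rw [if_pos (by omega)]
        · intro k _ hk
          rw [if_neg (by omega)]
        · intro hn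
          exact absurd (Finset.mem_range.2 hd) hn
      · rw [Polynomial.coeff_eq_zero_of_natDegree_lt (by omega)]
        apply Finset.sum_eq_zero
        intro k hk
        rw [Finset.mem_range] at hk
        rw [if_neg (by omega)]
    · apply Finset.sum_eq_zero
      intro k _
      rw [if_neg (by omega)]
  constructor
  · intro h d hd
    have := h2 ⟨0, by omega⟩ ⟨d, hd⟩
    rw [h] at this
    simpa using this.symm
  · intro h
    ext i j
    rw [h2]
    split_ifs
    · exact h _ (by omega)
    · rfl

theorem JordanForm.aeval_eq_zero_iff {n : ℕ} {M : Matrix (Fin n) (Fin n) ℂ} (J : JordanForm M)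
    (q : Polynomial ℂ) :
    Polynomial.aeval M q = 0 ↔
      ∀ i, (Polynomial.X - Polynomial.C (J.eigenvalue i)) ^ J.size i ∣ q := by
  classical
  let Ψ : (∀ i, Matrix (Fin (J.size i)) (Fin (J.size i)) ℂ) → Matrix (Fin n) (Fin n) ℂ :=
    fun A => (J.P : Matrix (Fin n) (Fin n) ℂ) *
      Matrix.reindex J.index J.index (Matrix.blockDiagonal' A) *
      ((J.P⁻¹ : GL (Fin n) ℂ) : Matrix (Fin n) (Fin n) ℂ)
  have hpow : ∀ k : ℕ, M ^ k =
      Ψ (fun i => jordanBlock (J.size i) (J.eigenvalue i) ^ k) := by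
    intro k
    conv_lhs => rw [J.eq_conj]
    rw [Units.conj_pow]
    simp only [Ψ]
    congr 2
    rw [← Matrix.coe_reindexAlgEquiv ℂ ℂ, ← map_pow, ← Matrix.blockDiagonal'_pow]
    rfl
  have hΨ : Polynomial.aeval M q =
      Ψ (fun i => Polynomial.aeval (jordanBlock (J.size i) (J.eigenvalue i)) q) := by
    induction q using Polynomial.induction_on' with
    | add p q hp hq =>
      rw [map_add, hp, hq]
      simp only [Ψ, map_add]
      rw [← add_mul, ← mul_add]
      congr 2
      ext i j
      simp only [Matrix.reindex_apply, Matrix.add_apply, Matrix.submatrix_apply]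
      rw [← Matrix.add_apply, ← Matrix.blockDiagonal'_add]
      rfl
    | monomial k a =>
      rw [Polynomial.aeval_monomial, hpow, ← Algebra.smul_def]
      simp only [Ψ, Polynomial.aeval_monomial, ← Algebra.smul_def]
      rw [← smul_mul_assoc, ← mul_smul_comm]
      congr 2
      ext i j
      simp only [Matrix.reindex_apply, Matrix.smul_apply, Matrix.submatrix_apply]
      rw [← Matrix.smul_apply, ← Matrix.blockDiagonal'_smul]
      rfl
  have hinj : ∀ A, Ψ A = 0 ↔ A = 0 := by
    intro A
    simp only [Ψ]
    rw [Units.mul_left_eq_zero, Units.mul_right_eq_zero, ← Matrix.coe_reindexAlgEquiv ℂ ℂ,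
      EmbeddingLike.map_eq_zero_iff, ← Matrix.blockDiagonal'_zero,
      Matrix.blockDiagonal'_injective.eq_iff]
  rw [hΨ, hinj, _root_.funext_iff]
  exact forall_congr' fun i => aeval_jordanBlock_eq_zero_iff _ _ _

/-- The largest Jordan block for `0` is the multiplicity of `0` as a root of the minimal
polynomial. -/
theorem nu_eq_rootMultiplicity {n : ℕ} (M : Matrix (Fin n) (Fin n) ℂ) :
    nu M = (minpoly ℂ M).rootMultiplicity 0 := by
  have hne : minpoly ℂ M ≠ 0 := minpoly.ne_zero (Matrix.isIntegral M)
  apply le_antisymm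
  · apply csSup_le'
    rintro m ⟨J, i, h0, rfl⟩
    rw [Polynomial.le_rootMultiplicity_iff hne, ← h0]
    exact (J.aeval_eq_zero_iff _).1 (minpoly.aeval ℂ M) i
  · obtain ⟨J⟩ := exists_jordanForm M
    let r : Polynomial ℂ := ∏ i, if J.eigenvalue i = 0 then 1 else
      (Polynomial.X - Polynomial.C (J.eigenvalue i)) ^ J.size i
    have hr : r.eval 0 ≠ 0 := by
      rw [Polynomial.eval_prod, Finset.prod_ne_zero_iff]
      intro i _
      split_ifs with h <;> simp [h]
    have hdvd : minpoly ℂ M ∣ Polynomial.X ^ nu M * r := by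
      rw [minpoly.dvd_iff, J.aeval_eq_zero_iff]
      intro i
      by_cases h : J.eigenvalue i = 0
      · apply Dvd.dvd.mul_right
        rw [h, Polynomial.C_0, sub_zero]
        exact pow_dvd_pow _ (le_csSup (bddAbove_zeroBlockSizes M) ⟨J, i, h, rfl⟩)
      · apply Dvd.dvd.mul_left
        have := Finset.dvd_prod_of_mem (fun i => if J.eigenvalue i = 0 then 1 else
          (Polynomial.X - Polynomial.C (J.eigenvalue i)) ^ J.size i) (Finset.mem_univ i)
        simpa only [if_neg h] using this
    have h1 := (Polynomial.pow_rootMultiplicity_dvd (minpoly ℂ M) 0).trans hdvd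
    rw [Polynomial.C_0, sub_zero] at h1
    have hcop : IsCoprime (Polynomial.X ^ (minpoly ℂ M).rootMultiplicity 0) r := by
      apply IsCoprime.pow_left
      rw [Polynomial.irreducible_X.coprime_iff_not_dvd, Polynomial.X_dvd_iff,
        Polynomial.coeff_zero_eq_eval_zero]
      exact hr
    exact (pow_dvd_pow_iff Polynomial.X_ne_zero Polynomial.not_isUnit_X).1
      (hcop.dvd_of_dvd_mul_right h1)

/-! ### Diagonalizability of powers -/

theorem isDiagonalizable_iff_exists_squarefree {n : ℕ} (A : Matrix (Fin n) (Fin n) ℂ) :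
    IsDiagonalizable A ↔ ∃ s : Polynomial ℂ, Squarefree s ∧ Polynomial.aeval A s = 0 := by
  classical
  constructor
  · rintro ⟨P, d, rfl⟩
    let s : Polynomial ℂ := ∏ c ∈ Finset.univ.image d, (Polynomial.X - Polynomial.C c)
    refine ⟨s, ?_, ?_⟩
    · exact (Polynomial.separable_prod_X_sub_C_iff' (f := id).2 (by simp)).squarefree
    · have haeval : ∀ p : Polynomial ℂ, Polynomial.aeval ((P : Matrix (Fin n) (Fin n) ℂ) *
          Matrix.diagonal d * ((P⁻¹ : GL (Fin n) ℂ) : Matrix (Fin n) (Fin n) ℂ)) p =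
          (P : Matrix (Fin n) (Fin n) ℂ) * Matrix.diagonal (fun i => p.eval (d i)) *
            ((P⁻¹ : GL (Fin n) ℂ) : Matrix (Fin n) (Fin n) ℂ) := by
        intro p
        induction p using Polynomial.induction_on' with
        | add p q hp hq =>
          rw [map_add, hp, hq, ← add_mul, ← mul_add, Matrix.diagonal_add]
          simp
        | monomial k a =>
          rw [Polynomial.aeval_monomial, Units.conj_pow, Matrix.diagonal_pow, ← Algebra.smul_def,
            ← smul_mul_assoc, ← mul_smul_comm, ← Matrix.diagonal_smul]
          congr 3
          ext i
          simp
      have hroot : ∀ i, s.eval (d i) = 0 := by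
        intro i
        rw [Polynomial.eval_prod]
        exact Finset.prod_eq_zero (Finset.mem_image_of_mem d (Finset.mem_univ i)) (by simp)
      rw [haeval]
      simp [hroot]
  · rintro ⟨s, hs, hA⟩
    obtain ⟨J⟩ := exists_jordanForm A
    rw [J.aeval_eq_zero_iff] at hA
    have hsize : ∀ i, J.size i = 1 := by
      intro i
      have h1 := J.size_pos i
      by_contra h
      have h2 : (Polynomial.X - Polynomial.C (J.eigenvalue i)) ^ 2 ∣ s :=
        (pow_dvd_pow _ (by omega)).trans (hA i)
      exact Polynomial.not_isUnit_X_sub_C _ (hs _ (by rwa [← sq]))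
    refine ⟨J.P, fun k => J.eigenvalue (J.index.symm k).1, ?_⟩
    conv_lhs => rw [J.eq_conj]
    congr 2
    ext x y
    obtain ⟨⟨i, a⟩, rfl⟩ := J.index.surjective x
    obtain ⟨⟨j, b⟩, rfl⟩ := J.index.surjective y
    simp only [Matrix.reindex_apply, Matrix.submatrix_apply, Equiv.symm_apply_apply,
      Matrix.diagonal_apply, EmbeddingLike.apply_eq_iff_eq]
    by_cases hij : i = j
    · subst hij
      have hab : a = b := by
        ext
        have := hsize i
        omega
      subst hab
      simp [jordanBlock]
    · rw [Matrix.blockDiagonal'_apply_ne _ _ _ hij, if_neg]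
      intro h
      exact hij (congrArg Sigma.fst h)

theorem dvd_of_rootMultiplicity_le {f g : Polynomial ℂ} (hf : f ≠ 0) (hg : g ≠ 0)
    (h : ∀ c, f.rootMultiplicity c ≤ g.rootMultiplicity c) : f ∣ g := by
  classical
  rw [IsAlgClosed.dvd_iff_roots_le_roots hf hg, Multiset.le_iff_count]
  simpa only [Polynomial.count_roots] using h

/-- Once `q` exceeds the largest Jordan block for `0`, diagonalizability of `M ^ q` means that the
Jordan blocks for nonzero eigenvalues have size one. -/
theorem isDiagonalizable_pow_iff {n : ℕ} (M : Matrix (Fin n) (Fin n) ℂ) {q : ℕ} (hq : 0 < q)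
    (hν : (minpoly ℂ M).rootMultiplicity 0 ≤ q) :
    IsDiagonalizable (M ^ q) ↔ ∀ c ≠ 0, (minpoly ℂ M).rootMultiplicity c ≤ 1 := by
  classical
  have hne : minpoly ℂ M ≠ 0 := minpoly.ne_zero (Matrix.isIntegral M)
  have haeval : ∀ s : Polynomial ℂ, Polynomial.aeval (M ^ q) s =
      Polynomial.aeval M (Polynomial.expand ℂ q s) := by
    intro s
    rw [Polynomial.expand_eq_comp_X_pow, Polynomial.aeval_comp]
    simp
  rw [isDiagonalizable_iff_exists_squarefree]
  constructor
  · rintro ⟨s, hs, h0⟩ c hc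
    rw [haeval, ← minpoly.dvd_iff] at h0
    by_contra hlt
    have h2 : (Polynomial.X - Polynomial.C c) ^ 2 ∣ Polynomial.expand ℂ q s :=
      (pow_dvd_pow _ (by omega)).trans ((Polynomial.pow_rootMultiplicity_dvd _ c).trans h0)
    have hsep := PerfectField.separable_iff_squarefree.2 hs
    -- a double root `c` of `s(X ^ q)` makes `c ^ q` a double root of `s`
    have hr : s.eval (c ^ q) = 0 := by
      rw [← Polynomial.expand_eval, ← Polynomial.IsRoot.def, ← Polynomial.dvd_iff_isRoot]
      exact (dvd_pow_self _ two_ne_zero).trans h2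
    have hr' : s.derivative.eval (c ^ q) = 0 := by
      obtain ⟨u, hu⟩ := h2
      have h3 := congrArg (fun p => Polynomial.eval c (Polynomial.derivative p)) hu
      simp only [Polynomial.derivative_expand, Polynomial.eval_mul, Polynomial.expand_eval] at h3
      simp [Polynomial.derivative_mul, Polynomial.derivative_pow] at h3
      rcases h3 with h3 | h3
      · exact h3
      · rcases h3 with h3 | h3
        · omega
        · exact absurd h3.1 hc
    obtain ⟨a, b, hab⟩ := hsep
    have h4 := congrArg (Polynomial.eval (c ^ q)) hab
    simp [hr, hr'] at h4
  · intro h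
    let E : Finset ℂ := insert 0 ((minpoly ℂ M).roots.toFinset.image (· ^ q))
    let s : Polynomial ℂ := ∏ c ∈ E, (Polynomial.X - Polynomial.C c)
    have hs : s ≠ 0 := Finset.prod_ne_zero_iff.2 fun c _ => Polynomial.X_sub_C_ne_zero c
    have hmem : ∀ c ∈ E, (Polynomial.X ^ q - Polynomial.C c) ∣ Polynomial.expand ℂ q s := by
      intro c hc
      have := map_dvd (Polynomial.expand ℂ q)
        (Finset.dvd_prod_of_mem (fun c => Polynomial.X - Polynomial.C c) hc)
      simpa [s] using this
    refine ⟨s, ?_, ?_⟩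
    · exact (Polynomial.separable_prod_X_sub_C_iff' (f := id).2 (by simp)).squarefree
    · rw [haeval, ← minpoly.dvd_iff]
      have hexp : Polynomial.expand ℂ q s ≠ 0 := (Polynomial.expand_ne_zero hq).2 hs
      apply dvd_of_rootMultiplicity_le hne hexp
      intro c
      rcases eq_or_ne c 0 with rfl | hc
      · refine hν.trans ?_
        rw [Polynomial.le_rootMultiplicity_iff hexp]
        simpa using hmem 0 (by simp [E])
      · by_cases hroot : (minpoly ℂ M).IsRoot c
        · refine (h c hc).trans ?_
          rw [Nat.succ_le_iff, Polynomial.rootMultiplicity_pos hexp, ← Polynomial.dvd_iff_isRoot]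
          refine Dvd.dvd.trans ?_ (hmem (c ^ q) ?_)
          · rw [Polynomial.dvd_iff_isRoot]; simp
          · simp only [E, Finset.mem_insert, Finset.mem_image, Multiset.mem_toFinset,
              Polynomial.mem_roots hne]
            exact Or.inr ⟨c, hroot, rfl⟩
        · rw [Polynomial.rootMultiplicity_eq_zero hroot]
          exact Nat.zero_le _

/-! ### Exponential polynomials -/

/-- The shift `x ↦ (k ↦ x (k + 1))` on complex sequences. -/
def shift : Module.End ℂ (ℕ → ℂ) where
  toFun x k := x (k + 1)
  map_add' _ _ := rfl
  map_smul' _ _ := rfl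

@[simp]
theorem shift_apply (x : ℕ → ℂ) (k : ℕ) : shift x k = x (k + 1) := rfl

theorem shift_pow_apply (i : ℕ) (x : ℕ → ℂ) (k : ℕ) : (shift ^ i) x k = x (k + i) := by
  induction i generalizing x with
  | zero => rfl
  | succ i ih =>
    rw [pow_succ, Module.End.mul_apply, ih, shift_apply]
    rfl

theorem aeval_shift_apply (P : Polynomial ℂ) (x : ℕ → ℂ) (k : ℕ) :
    Polynomial.aeval shift P x k = ∑ i ∈ Finset.range (P.natDegree + 1), P.coeff i * x (k + i) := by
  rw [Polynomial.aeval_eq_sum_range, LinearMap.sum_apply, Finset.sum_apply]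
  simp [shift_pow_apply]

/-- The exponential polynomial sequence `k ↦ p(k) μ^k`. -/
def expPoly (p : Polynomial ℂ) (μ : ℂ) (k : ℕ) : ℂ := p.eval (k : ℂ) * μ ^ k

/-- `shift - μ` replaces `p` by `μ (p(X + 1) - p(X))`, which lowers the degree. -/
theorem shift_sub_pow_expPoly (n : ℕ) (p : Polynomial ℂ) (μ : ℂ) (hp : p.degree < n) :
    ((shift - algebraMap ℂ (Module.End ℂ (ℕ → ℂ)) μ) ^ n) (expPoly p μ) = 0 := by
  induction n generalizing p with
  | zero =>
    have : p = 0 := by simpa [Polynomial.degree_lt_iff_coeff_zero, Polynomial.ext_iff] using hp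
    subst this
    ext k
    simp [expPoly]
  | succ n ih =>
    have h1 : (shift - algebraMap ℂ (Module.End ℂ (ℕ → ℂ)) μ) (expPoly p μ) =
        expPoly (Polynomial.C μ * (Polynomial.taylor 1 p - p)) μ := by
      ext k
      simp only [LinearMap.sub_apply, Module.algebraMap_end_apply, Pi.sub_apply, shift_apply,
        Pi.smul_apply, smul_eq_mul, expPoly, Polynomial.eval_mul, Polynomial.eval_C,
        Polynomial.eval_sub, Polynomial.taylor_eval]
      push_cast
      ring
    rw [pow_succ, Module.End.mul_apply, h1]
    apply ih
    by_cases hp0 : p = 0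
    · simp [hp0]
    have h2 : (Polynomial.taylor 1 p - p).degree < p.degree := by
      have := Polynomial.degree_sub_lt_left (Polynomial.degree_taylor p 1)
        (by simpa using hp0) (Polynomial.leadingCoeff_taylor 1 p)
      rwa [Polynomial.degree_taylor] at this
    have h3 : p.degree ≤ n := by
      apply Polynomial.degree_le_of_natDegree_le
      have := (Polynomial.natDegree_lt_iff_degree_lt hp0).2 hp
      omega
    rw [← Polynomial.smul_eq_C_mul]
    exact (Polynomial.degree_smul_le _ _).trans_lt (h2.trans_le h3)

/-- Exponential polynomials with distinct nonzero bases are linearly independent: they lie in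
distinct generalized eigenspaces of the shift. -/
theorem eq_zero_of_sum_expPoly_eq_zero (s : Finset ℂ) (hs : 0 ∉ s) (p : ℂ → Polynomial ℂ)
    (k₀ t : ℕ) (ht : 0 < t)
    (h : ∀ i : ℕ, ∑ μ ∈ s, (p μ).eval ((k₀ + t * i : ℕ) : ℂ) * μ ^ i = 0) :
    ∀ μ ∈ s, p μ = 0 := by
  intro μ hμ
  have hind := Module.End.independent_maxGenEigenspace shift
  rw [iSupIndep_iff_finsetSum_eq_zero_imp_eq_zero] at hind
  let L : Polynomial ℂ := Polynomial.C (k₀ : ℂ) + Polynomial.C (t : ℂ) * Polynomial.X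
  have hmem : ∀ μ ∈ s, expPoly ((p μ).comp L) μ ∈ shift.maxGenEigenspace μ := by
    intro μ _
    rw [Module.End.mem_maxGenEigenspace]
    refine ⟨((p μ).comp L).natDegree + 1, ?_⟩
    exact shift_sub_pow_expPoly _ _ _ (Polynomial.degree_lt_iff_coeff_zero _ _ |>.2 fun m hm =>
      Polynomial.coeff_eq_zero_of_natDegree_lt (by omega))
  have h0 := hind s (fun μ => expPoly ((p μ).comp L) μ) hmem (by
    ext i
    rw [Finset.sum_apply]
    simpa [expPoly, L] using h i) μ hμ
  have hμ0 : μ ≠ 0 := fun h => hs (h ▸ hμ)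
  refine Polynomial.eq_zero_of_infinite_isRoot _ (Set.Infinite.mono
    (s := Set.range fun i : ℕ => ((k₀ + t * i : ℕ) : ℂ)) ?_ (Set.infinite_range_of_injective ?_))
  · rintro _ ⟨i, rfl⟩
    have h1 := congrFun h0 i
    simpa [expPoly, L, hμ0] using h1
  · intro i j hij
    have : k₀ + t * i = k₀ + t * j := Nat.cast_injective (R := ℂ) hij
    simpa [ht.ne'] using this

/-- A sequence satisfying a monic recurrence is determined by its initial values. -/
theorem eq_zero_of_aeval_shift_eq_zero {P : Polynomial ℂ} (hP : P.Monic) {x : ℕ → ℂ}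
    (hx : Polynomial.aeval shift P x = 0) (h0 : ∀ k < P.natDegree, x k = 0) : x = 0 := by
  ext k
  induction k using Nat.strong_induction_on with
  | _ k ih =>
    by_cases hk : k < P.natDegree
    · exact h0 k hk
    · have h1 := congrFun hx (k - P.natDegree)
      rw [aeval_shift_apply, Finset.sum_range_succ, hP.coeff_natDegree, one_mul,
        Nat.sub_add_cancel (not_lt.1 hk), Finset.sum_eq_zero, zero_add] at h1
      · exact h1
      · intro i hi
        rw [Finset.mem_range] at hi
        rw [ih _ (by omega)]
        simp

/-! ### Entries of powers as exponential polynomials -/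

section Entries

variable {n : ℕ} (M : Matrix (Fin n) (Fin n) ℂ)

/-- The nonzero roots of the minimal polynomial. -/
noncomputable def nonzeroRoots : Finset ℂ := (minpoly ℂ M).roots.toFinset.erase 0

/-- The indices `(c, j)` of the sequences `c ^ k * k ^ j`: `c` is a nonzero eigenvalue and `j` is
less than its multiplicity in the minimal polynomial. -/
abbrev ExpIndex : Type :=
  Σ c : {c // c ∈ nonzeroRoots M}, Fin ((minpoly ℂ M).rootMultiplicity c.1)

/-- The entries of `M ^ k`, for `k` at least the multiplicity of `0` in the minimal polynomial, and
the sequences `c ^ k * k ^ j` are linear combinations of each other: both span the space of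
solutions of the linear recurrence given by the minimal polynomial without its factor `X ^ ν`. -/
theorem exists_linear_relations {q : ℕ} (hq : (minpoly ℂ M).rootMultiplicity 0 ≤ q) :
    ∃ (A : Fin n × Fin n → ExpIndex M → ℂ) (A' : ExpIndex M → Fin n × Fin n → ℂ),
      ∀ k, q ≤ k →
        (∀ p, entries (M ^ k) p = ∑ i, A p i * (i.1.1 ^ k * (k : ℂ) ^ (i.2 : ℕ))) ∧
        ∀ i, i.1.1 ^ k * (k : ℂ) ^ (i.2 : ℕ) = ∑ p, A' i p * entries (M ^ k) p := by
  classical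
  set f := minpoly ℂ M with hf
  have hmon : f.Monic := minpoly.monic (Matrix.isIntegral M)
  have hne : f ≠ 0 := hmon.ne_zero
  obtain ⟨P, hfP, hPX⟩ := Polynomial.exists_eq_pow_rootMultiplicity_mul_and_not_dvd f hne 0
  rw [Polynomial.C_0, sub_zero] at hfP hPX
  have hPmon : P.Monic := (Polynomial.monic_X_pow _).of_mul_monic_left (hfP ▸ hmon)
  have hcop : IsCoprime P (Polynomial.X ^ q) := by
    apply IsCoprime.pow_right
    exact ((Polynomial.irreducible_X.coprime_iff_not_dvd).2 hPX).symm
  have hmult : ∀ c ≠ 0, P.rootMultiplicity c = f.rootMultiplicity c := by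
    intro c hc
    conv_rhs => rw [hfP]
    rw [Polynomial.rootMultiplicity_mul (by rw [← hfP]; exact hne),
      Polynomial.rootMultiplicity_eq_zero (p := Polynomial.X ^ _), zero_add]
    simp [hc]
  have hcard : Fintype.card (ExpIndex M) = P.natDegree := by
    have h1 : ∀ c : {c // c ∈ nonzeroRoots M}, Fintype.card (Fin (f.rootMultiplicity c.1)) =
        P.roots.count c.1 := by
      intro c
      rw [Fintype.card_fin, Polynomial.count_roots, hmult _ (Finset.ne_of_mem_erase c.2)]
    rw [Fintype.card_sigma, Finset.sum_congr rfl fun c _ => h1 c,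
      Finset.sum_coe_sort (nonzeroRoots M) fun c => P.roots.count c, Multiset.sum_count_eq_card,
      ← (IsAlgClosed.splits P).natDegree_eq_card_roots]
    intro c hc
    have hroot := (Polynomial.mem_roots hPmon.ne_zero).1 hc
    rw [nonzeroRoots, Finset.mem_erase, Multiset.mem_toFinset, Polynomial.mem_roots hne]
    constructor
    · rintro rfl
      rw [Polynomial.IsRoot.def, ← Polynomial.coeff_zero_eq_eval_zero, ← Polynomial.X_dvd_iff]
        at hroot
      exact hPX hroot
    · rw [hfP, Polynomial.IsRoot.def, Polynomial.eval_mul, hroot.eq_zero, mul_zero]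
  let W : Submodule ℂ (ℕ → ℂ) := LinearMap.ker (Polynomial.aeval shift P)
  let res : W →ₗ[ℂ] (Fin P.natDegree → ℂ) :=
    { toFun := fun x k => x.1 k
      map_add' := fun _ _ => rfl
      map_smul' := fun _ _ => rfl }
  have hres : Function.Injective res := by
    rw [← LinearMap.ker_eq_bot, LinearMap.ker_eq_bot']
    intro x hx
    apply Subtype.ext
    exact eq_zero_of_aeval_shift_eq_zero hPmon x.2 fun k hk => congrFun hx ⟨k, hk⟩
  have hfin : FiniteDimensional ℂ W := FiniteDimensional.of_injective res hres
  -- the sequences `c ^ (q + k) * (q + k) ^ j` form a basis of the solutions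
  let b : ExpIndex M → W := fun i =>
    ⟨fun k => i.1.1 ^ (q + k) * ((q + k : ℕ) : ℂ) ^ (i.2 : ℕ), by
      have h1 : (fun k : ℕ => i.1.1 ^ (q + k) * ((q + k : ℕ) : ℂ) ^ (i.2 : ℕ)) =
          expPoly (Polynomial.C (i.1.1 ^ q) * (Polynomial.X + Polynomial.C (q : ℂ)) ^ (i.2 : ℕ))
            i.1.1 := by
        ext k
        simp only [expPoly, Polynomial.eval_mul, Polynomial.eval_C, Polynomial.eval_pow,
          Polynomial.eval_add, Polynomial.eval_X, pow_add]
        push_cast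
        ring
      obtain ⟨u, hu⟩ := Polynomial.pow_rootMultiplicity_dvd P i.1.1
      rw [hmult _ (Finset.ne_of_mem_erase i.1.2), mul_comm] at hu
      rw [LinearMap.mem_ker, hu, map_mul, Module.End.mul_apply, map_pow, map_sub,
        Polynomial.aeval_X, Polynomial.aeval_C, h1, shift_sub_pow_expPoly, map_zero]
      refine lt_of_le_of_lt (b := ((i.2 : ℕ) : WithBot ℕ)) ?_ (by exact_mod_cast i.2.2)
      rw [← Polynomial.smul_eq_C_mul]
      refine (Polynomial.degree_smul_le _ _).trans ?_
      refine (Polynomial.degree_pow_le _ _).trans ?_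
      rw [Polynomial.degree_X_add_C]
      simp⟩
  have hb : LinearIndependent ℂ b := by
    rw [Fintype.linearIndependent_iff]
    intro g hg
    let p : ℂ → Polynomial ℂ := fun c => if hc : c ∈ nonzeroRoots M then
      ∑ j : Fin (f.rootMultiplicity c), Polynomial.C (g ⟨⟨c, hc⟩, j⟩ * c ^ q) *
        Polynomial.X ^ (j : ℕ) else 0
    have h1 := eq_zero_of_sum_expPoly_eq_zero (nonzeroRoots M) (Finset.notMem_erase _ _) p q 1
      one_pos (by
        intro k
        have h2 := congrFun (congrArg Subtype.val hg) k
        rw [← Finset.sum_coe_sort]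
        simp only [Submodule.coe_sum, Finset.sum_apply, Submodule.coe_smul, Pi.smul_apply,
          smul_eq_mul, Submodule.coe_zero, Pi.zero_apply, b, Fintype.sum_sigma] at h2
        rw [← h2]
        refine Finset.sum_congr rfl fun c _ => ?_
        simp only [p, c.2, dif_pos, Polynomial.eval_finsetSum, Polynomial.eval_mul,
          Polynomial.eval_C, Polynomial.eval_pow, Polynomial.eval_X, Finset.sum_mul, one_mul,
          pow_add]
        refine Finset.sum_congr rfl fun j _ => ?_
        ring)
    rintro ⟨⟨c, hc⟩, j⟩
    have h3 := congrArg (fun r => Polynomial.coeff r (j : ℕ)) (h1 c hc)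
    simp only [p, hc, dif_pos, Polynomial.finsetSum_coeff, Polynomial.coeff_C_mul,
      Polynomial.coeff_X_pow, Polynomial.coeff_zero] at h3
    rw [Finset.sum_eq_single j] at h3
    · have hc0 : c ≠ 0 := Finset.ne_of_mem_erase hc
      simpa [hc0] using h3
    · intro x _ hx
      rw [if_neg (fun h => hx (Fin.ext h.symm)), mul_zero]
    · simp
  have hspan : Submodule.span ℂ (Set.range b) = ⊤ := by
    apply hb.span_eq_top_of_card_eq_finrank'
    apply le_antisymm
    · exact hb.fintype_card_le_finrank
    · have := LinearMap.finrank_le_finrank_of_injective hres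
      rw [hcard]
      simpa using this
  have hpow : ∀ k, ∑ i ∈ Finset.range (P.natDegree + 1), P.coeff i • M ^ (q + (k + i)) = 0 := by
    intro k
    have h1 : Polynomial.aeval M (Polynomial.X ^ (q + k) * P) = 0 := by
      rw [← minpoly.dvd_iff, ← hf]
      conv_lhs => rw [hfP]
      exact mul_dvd_mul_right (pow_dvd_pow _ (by omega)) _
    rw [map_mul, map_pow, Polynomial.aeval_X, Polynomial.aeval_eq_sum_range, Finset.mul_sum] at h1
    rw [← h1]
    refine Finset.sum_congr rfl fun i _ => ?_
    rw [mul_smul_comm, ← pow_add, add_assoc]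
  have hA : ∀ p, ∃ a : ExpIndex M → ℂ, ∀ k,
      entries (M ^ (q + k)) p = ∑ i, a i * (i.1.1 ^ (q + k) * ((q + k : ℕ) : ℂ) ^ (i.2 : ℕ)) := by
    intro p
    have hW : (fun k => entries (M ^ (q + k)) p) ∈ W := by
      rw [LinearMap.mem_ker]
      ext k
      rw [aeval_shift_apply]
      have := congrFun (congrFun (hpow k) p.1) p.2
      simpa [Matrix.sum_apply, entries] using this
    have hm : (⟨_, hW⟩ : W) ∈ Submodule.span ℂ (Set.range b) := by rw [hspan]; trivial
    obtain ⟨a, ha⟩ := (Submodule.mem_span_range_iff_exists_fun ℂ).1 hm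
    refine ⟨a, fun k => ?_⟩
    have := congrFun (congrArg Subtype.val ha) k
    simpa [b] using this.symm
  have hli : LinearIndependent ℂ fun i : Fin P.natDegree => M ^ (q + (i : ℕ)) := by
    rw [Fintype.linearIndependent_iff]
    intro g hg
    set r : Polynomial ℂ := ∑ i : Fin P.natDegree, Polynomial.C (g i) * Polynomial.X ^ (i : ℕ)
      with hr
    have h1 : Polynomial.aeval M (r * Polynomial.X ^ q) = 0 := by
      rw [map_mul, map_pow, Polynomial.aeval_X, hr, map_sum, Finset.sum_mul, ← hg]
      refine Finset.sum_congr rfl fun i _ => ?_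
      rw [map_mul, Polynomial.aeval_C, map_pow, Polynomial.aeval_X, ← Algebra.smul_def,
        smul_mul_assoc, ← pow_add, add_comm]
    rw [← minpoly.dvd_iff, ← hf] at h1
    have h2 : P ∣ r := hcop.dvd_of_dvd_mul_right ((Dvd.intro_left _ hfP.symm).trans h1)
    have h3 : r = 0 := by
      by_contra h
      have := Polynomial.degree_le_of_dvd h2 h
      rw [Polynomial.degree_eq_natDegree hPmon.ne_zero] at this
      exact absurd this (not_le.2 (Polynomial.degree_sum_fin_lt g))
    intro i
    have h4 := congrArg (fun p => Polynomial.coeff p (i : ℕ)) h3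
    simp only [hr, Polynomial.finsetSum_coeff, Polynomial.coeff_C_mul, Polynomial.coeff_X_pow,
      Polynomial.coeff_zero] at h4
    rw [Finset.sum_eq_single i] at h4
    · simpa using h4
    · intro x _ hx
      rw [if_neg (fun h => hx (Fin.ext h.symm)), mul_zero]
    · simp
  -- the powers `M ^ (q + i)`, `i < deg P`, are independent, so a linear functional may take
  -- arbitrary values at them, and these determine a solution of the recurrence
  have hA' : ∀ x ∈ W, ∃ a : Fin n × Fin n → ℂ, ∀ k, x k = ∑ p, a p * entries (M ^ (q + k)) p := by
    intro x hx
    obtain ⟨φ, hφ⟩ : ∃ φ : Matrix (Fin n) (Fin n) ℂ →ₗ[ℂ] ℂ,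
        ∀ i : Fin P.natDegree, φ (M ^ (q + (i : ℕ))) = x i := by
      obtain ⟨g, hg⟩ := LinearMap.exists_leftInverse_of_injective _ (LinearMap.ker_eq_bot.2 hli)
      refine ⟨(Finsupp.linearCombination ℂ fun i : Fin P.natDegree => x i).comp g, fun i => ?_⟩
      have := LinearMap.congr_fun hg (Finsupp.single i 1)
      rw [LinearMap.comp_apply, Finsupp.linearCombination_single, one_smul] at this
      rw [LinearMap.comp_apply, this]
      simp
    have hφx : (fun k => φ (M ^ (q + k))) - x = 0 := by
      apply eq_zero_of_aeval_shift_eq_zero hPmon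
      · rw [map_sub, LinearMap.mem_ker.1 hx, sub_zero]
        ext k
        rw [aeval_shift_apply]
        have := congrArg φ (hpow k)
        simpa using this
      · intro k hk
        simpa [sub_eq_zero] using hφ ⟨k, hk⟩
    refine ⟨fun p => φ (Matrix.single p.1 p.2 1), fun k => ?_⟩
    have h1 : φ (M ^ (q + k)) = x k := sub_eq_zero.1 (congrFun hφx k)
    rw [← h1]
    conv_lhs => rw [Matrix.matrix_eq_sum_single (M ^ (q + k))]
    simp only [map_sum, Fintype.sum_prod_type, entries]
    refine Finset.sum_congr rfl fun i _ => Finset.sum_congr rfl fun j _ => ?_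
    rw [mul_comm, ← smul_eq_mul, ← map_smul, Matrix.smul_single, smul_eq_mul, mul_one]
  choose A hA using hA
  choose A' hA' using fun i => hA' _ (b i).2
  refine ⟨A, A', fun k hk => ?_⟩
  obtain ⟨k, rfl⟩ := Nat.exists_eq_add_of_le hk
  exact ⟨fun p => hA p k, fun i => hA' i k⟩

end Entries

/-! ### Finitely generated multiplicative groups -/

theorem finite_torsion_closure {S : Set ℂˣ} (hS : S.Finite) :
    Finite (CommGroup.torsion (Subgroup.closure S)) := by
  have := hS.to_subtype
  have hfg : Group.FG (Subgroup.closure S) := Group.closure_finite_fg S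
  have : Module.Finite ℤ (Additive (Subgroup.closure S)) := inferInstance
  have hfin : Finite (Submodule.torsion ℤ (Additive (Subgroup.closure S))) :=
    Module.finite_of_fg_torsion _ Submodule.torsion_isTorsion
  refine Finite.of_injective (β := Submodule.torsion ℤ (Additive (Subgroup.closure S)))
    (fun x => ⟨Additive.ofMul x.1, ?_⟩) ?_
  · have h1 : Additive.ofMul x.1 ∈ (Submodule.torsion ℤ _).toAddSubgroup := by
      rw [Submodule.torsion_int]
      exact isOfFinAddOrder_ofMul_iff.2 x.2
    exact h1
  · intro x y h
    exact Subtype.ext (Additive.ofMul.injective (Subtype.mk.inj h))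

/-- The torsion subgroup of a finitely generated multiplicative group is cyclic. -/
theorem exists_orderOf_eq_card_torsion {S : Set ℂˣ} (hS : S.Finite) :
    ∃ ζ ∈ Subgroup.closure S,
      orderOf ζ = Nat.card (CommGroup.torsion (Subgroup.closure S)) := by
  have := finite_torsion_closure hS
  have hc : IsCyclic (CommGroup.torsion (Subgroup.closure S)) :=
    isCyclic_of_injective_ringHom
      (((Units.coeHom ℂ).comp (Subgroup.closure S).subtype).comp
        (CommGroup.torsion (Subgroup.closure S)).subtype)
      (Units.val_injective.comp (Subtype.val_injective.comp Subtype.val_injective))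
  obtain ⟨z, hz⟩ := hc.exists_generator
  refine ⟨z.1.1, z.1.2, ?_⟩
  rw [Subgroup.orderOf_coe, Subgroup.orderOf_coe]
  exact orderOf_eq_card_of_forall_mem_zpowers hz

/-- Up to torsion, the group generated by `S` is free on elements `g j`, in which the members `u`
of `S` have the coordinates `a u`. -/
theorem exists_free_coordinates {S : Set ℂˣ} (hS : S.Finite) {r : ℕ}
    (hr : Module.finrank ℤ (Additive (Subgroup.closure S)) = r) :
    ∃ (g : Fin r → ℂˣ) (a : ℂˣ → Fin r → ℤ),
      (∀ e : Fin r → ℤ, ∏ j, g j ^ e j = 1 → e = 0) ∧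
      (∀ u ∈ S, (u * (∏ j, g j ^ a u j)⁻¹) ^
        Nat.card (CommGroup.torsion (Subgroup.closure S)) = 1) ∧
      AddSubgroup.closure (a '' S) = ⊤ := by
  classical
  have := hS.to_subtype
  have hfg : Group.FG (Subgroup.closure S) := Group.closure_finite_fg S
  have := finite_torsion_closure hS
  set G := Subgroup.closure S with hG
  let T : Submodule ℤ (Additive G) := Submodule.torsion ℤ (Additive G)
  have hQ : Module.finrank ℤ (Additive G ⧸ T) = r := by
    rw [finrank_quotient_eq_of_le_torsion le_rfl, hr]
  let β : Module.Basis (Fin r) ℤ (Additive G ⧸ T) := (Module.finBasis ℤ _).reindex (finCongr hQ)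
  choose w hw using fun j => T.mkQ_surjective (β j)
  let g : Fin r → ℂˣ := fun j => (w j).toMul.1
  let φ : Additive G →+ (Fin r → ℤ) := (β.equivFun.toLinearMap.comp T.mkQ).toAddMonoidHom
  have hφ : ∀ x : Additive G, T.mkQ x = ∑ j, φ x j • β j := fun x => (β.sum_equivFun _).symm
  have hprod : ∀ e : Fin r → ℤ, ((∑ j, e j • w j).toMul : G).1 = ∏ j, g j ^ e j := by
    intro e
    rw [toMul_sum, Subgroup.val_finsetProd]
    simp [g]
  let a : ℂˣ → Fin r → ℤ := fun u => if h : u ∈ G then φ (Additive.ofMul ⟨u, h⟩) else 0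
  have ha : ∀ u (h : u ∈ G), a u = φ (Additive.ofMul ⟨u, h⟩) := fun u h => dif_pos h
  refine ⟨g, a, ?_, ?_, ?_⟩
  · intro e he
    rw [← hprod] at he
    have h1 : ∑ j, e j • w j = 0 := by
      apply Additive.toMul.injective
      exact Subtype.ext he
    have h2 := congrArg T.mkQ h1
    simp only [map_sum, map_smul, hw, map_zero] at h2
    exact _root_.funext (Fintype.linearIndependent_iff.1 β.linearIndependent e h2)
  · intro u hu
    have huG : u ∈ G := Subgroup.subset_closure hu
    let x : Additive G := Additive.ofMul ⟨u, huG⟩ - ∑ j, a u j • w j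
    have hx : x ∈ T := by
      rw [← Submodule.ker_mkQ T, LinearMap.mem_ker, map_sub, hφ, ← ha u huG]
      simp [hw]
    have hx' : x.toMul ∈ CommGroup.torsion G := by
      have h1 : x ∈ (Submodule.torsion ℤ (Additive G)).toAddSubgroup := hx
      rw [Submodule.torsion_int] at h1
      exact isOfFinAddOrder_ofMul_iff.1 h1
    have h2 : (⟨x.toMul, hx'⟩ : CommGroup.torsion G) ^ Nat.card (CommGroup.torsion G) = 1 :=
      pow_card_eq_one'
    have h3 := congrArg (fun z : CommGroup.torsion G => (z.1.1 : ℂˣ)) h2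
    have h4 : (x.toMul : G).1 = u * (∏ j, g j ^ a u j)⁻¹ := by
      rw [← hprod]
      simp [x, toMul_sub, div_eq_mul_inv]
    simpa only [SubmonoidClass.coe_pow, h4, OneMemClass.coe_one] using h3
  · rw [eq_top_iff]
    intro v _
    obtain ⟨x, rfl⟩ : ∃ x, φ x = v := (β.equivFun.surjective.comp T.mkQ_surjective) v
    obtain ⟨⟨y, hy⟩, rfl⟩ := Additive.ofMul.surjective x
    induction hy using Subgroup.closure_induction with
    | mem u hu =>
      rw [← ha]
      exact AddSubgroup.subset_closure ⟨u, hu, rfl⟩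
    | one =>
      have : φ (Additive.ofMul (1 : G)) = 0 := map_zero φ
      exact this ▸ AddSubgroup.zero_mem _
    | mul u v hu hv ihu ihv =>
      have : φ (Additive.ofMul (⟨u, hu⟩ * ⟨v, hv⟩ : G)) = φ (Additive.ofMul ⟨u, hu⟩) +
        φ (Additive.ofMul ⟨v, hv⟩) := map_add φ _ _
      exact this ▸ AddSubgroup.add_mem _ (ihu trivial) (ihv trivial)
    | inv u hu ihu =>
      have : φ (Additive.ofMul (⟨u, hu⟩⁻¹ : G)) = - φ (Additive.ofMul ⟨u, hu⟩) := map_neg φ _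
      exact this ▸ AddSubgroup.neg_mem _ (ihu trivial)

/-! ### Zariski density of exponential sequences in the torus -/

/-- Evaluation of Laurent polynomials at a point of the torus. -/
noncomputable def evalLaurent {κ : Type} [Fintype κ] (x : κ → ℂˣ) : Laurent κ →ₐ[ℂ] ℂ :=
  AddMonoidAlgebra.lift ℂ ℂ (κ → ℤ)
    { toFun := fun b => ((∏ j, x j ^ (Multiplicative.toAdd b j) : ℂˣ) : ℂ)
      map_one' := by simp
      map_mul' := fun b b' => by
        rw [← Units.val_mul, ← Finset.prod_mul_distrib]
        simp [zpow_add] }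

theorem evalLaurent_apply {κ : Type} [Fintype κ] (x : κ → ℂˣ) (F : Laurent κ) :
    evalLaurent x F = F.coeff.sum fun b c => c * ((∏ j, x j ^ b j : ℂˣ) : ℂ) := by
  rw [evalLaurent, AddMonoidAlgebra.lift_apply]
  rfl

@[simp]
theorem evalLaurent_monomial {κ : Type} [Fintype κ] (x : κ → ℂˣ) (b : κ → ℤ) :
    evalLaurent x (laurentMonomial b) = ((∏ j, x j ^ b j : ℂˣ) : ℂ) := by
  rw [evalLaurent_apply, AddMonoidAlgebra.coeff_single, Finsupp.sum_single_index] <;> simp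

/-- The point `(g₁ ^ k, …, g_r ^ k, k, …, k)` of the torus, for `k ≠ 0`
(the last coordinates are `1` for `k = 0`). -/
noncomputable def expPoint {r ε : ℕ} (g : Fin r → ℂˣ) (k : ℕ) : Fin r ⊕ Fin ε → ℂˣ :=
  Sum.elim (fun j => g j ^ k) fun _ => if h : (k : ℂ) ≠ 0 then Units.mk0 (k : ℂ) h else 1

theorem expPoint_prod {r ε : ℕ} (g : Fin r → ℂˣ) {k : ℕ} (hk : 0 < k)
    (b : Fin r ⊕ Fin ε → ℤ) :
    ((∏ j, expPoint g k j ^ b j : ℂˣ) : ℂ) =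
      ((∏ j, g j ^ b (Sum.inl j) : ℂˣ) : ℂ) ^ k * (k : ℂ) ^ ∑ s, b (Sum.inr s) := by
  have hk' : (k : ℂ) ≠ 0 := by exact_mod_cast hk.ne'
  rw [Fintype.prod_sum_type, Units.val_mul]
  congr 1
  · rw [← Units.val_pow_eq_pow_val]
    congr 1
    rw [← Finset.prod_pow]
    refine Finset.prod_congr rfl fun j _ => ?_
    simp only [expPoint, Sum.elim_inl]
    rw [← zpow_natCast, ← zpow_natCast, ← zpow_mul, ← zpow_mul, mul_comm]
  · simp only [expPoint, Sum.elim_inr, dif_pos hk']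
    have hsum : ∀ s : Finset (Fin ε), ∏ x ∈ s, Units.mk0 (k : ℂ) hk' ^ b (Sum.inr x) =
        Units.mk0 (k : ℂ) hk' ^ ∑ x ∈ s, b (Sum.inr x) := by
      intro s
      induction s using Finset.cons_induction with
      | empty => simp
      | cons a s ha ih => rw [Finset.prod_cons, Finset.sum_cons, zpow_add, ih]
    rw [hsum]
    simp

/-- For multiplicatively independent `g`, a Laurent polynomial that vanishes at the points
`(g ^ k, k)`, or at the points `g ^ k`, for all `k` in an arithmetic progression is zero. -/
theorem laurent_eq_zero {r ε : ℕ} (hε : ε ≤ 1) (g : Fin r → ℂˣ)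
    (hg : ∀ e : Fin r → ℤ, ∏ j, g j ^ e j = 1 → e = 0) (k₀ t : ℕ) (hk₀ : 0 < k₀) (ht : 0 < t)
    (F : Laurent (Fin r ⊕ Fin ε))
    (h : ∀ i : ℕ, evalLaurent (expPoint g (k₀ + t * i)) F = 0) : F = 0 := by
  classical
  -- the exponents of `k` are made nonnegative by multiplication with `k ^ L`
  let L : ℕ := ∑ b ∈ F.coeff.support, (∑ s, b (Sum.inr s)).natAbs
  let m : (Fin r ⊕ Fin ε → ℤ) → ℕ := fun b => ((L : ℤ) + ∑ s, b (Sum.inr s)).toNat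
  have hm : ∀ b ∈ F.coeff.support, (m b : ℤ) = L + ∑ s, b (Sum.inr s) := by
    intro b hb
    apply Int.toNat_of_nonneg
    have h1 : (∑ s, b (Sum.inr s)).natAbs ≤ L :=
      Finset.single_le_sum (f := fun b : Fin r ⊕ Fin ε → ℤ => (∑ s, b (Sum.inr s)).natAbs)
        (fun _ _ => Nat.zero_le _) hb
    omega
  let G : (Fin r ⊕ Fin ε → ℤ) → ℂˣ := fun b => ∏ j, g j ^ b (Sum.inl j)
  let μ : (Fin r ⊕ Fin ε → ℤ) → ℂ := fun b => (G b : ℂ) ^ t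
  have hμ : ∀ b b', μ b = μ b' → ∀ j, b (Sum.inl j) = b' (Sum.inl j) := by
    intro b b' hbb j
    have h1 : G b ^ t = G b' ^ t := by
      apply Units.ext
      simpa [μ] using hbb
    have h2 : ∏ j, g j ^ ((t : ℤ) * (b (Sum.inl j) - b' (Sum.inl j))) = 1 := by
      simp only [mul_comm (t : ℤ), zpow_mul, zpow_natCast, Finset.prod_pow, zpow_sub,
        Finset.prod_mul_distrib, Finset.prod_inv_distrib, mul_pow, inv_pow]
      simp only [G] at h1
      rw [h1, mul_inv_cancel]
    have h3 := congrFun (hg _ h2) j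
    simp only [Pi.zero_apply, mul_eq_zero, Int.natCast_eq_zero, ht.ne', false_or] at h3
    omega
  -- on the monomials with `μ b = z` the exponents of `g` are constant, only that of `k` varies
  let p : ℂ → Polynomial ℂ := fun z => ∑ b ∈ F.coeff.support with μ b = z,
    Polynomial.C (F.coeff b * (G b : ℂ) ^ k₀) * Polynomial.X ^ m b
  have hp := eq_zero_of_sum_expPoly_eq_zero (F.coeff.support.image μ) (by
      simp [μ]) p k₀ t ht (by
    intro i
    have hk : 0 < k₀ + t * i := by omega
    have hk' : ((k₀ + t * i : ℕ) : ℂ) ≠ 0 := by exact_mod_cast hk.ne'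
    have h1 := h i
    rw [evalLaurent_apply, Finsupp.sum] at h1
    simp only [expPoint_prod g hk] at h1
    have h2 := congrArg (((k₀ + t * i : ℕ) : ℂ) ^ L * ·) h1
    simp only [mul_zero, Finset.mul_sum] at h2
    rw [← h2, ← Finset.sum_fiberwise_of_maps_to (g := μ) (t := F.coeff.support.image μ)
      (fun b hb => Finset.mem_image_of_mem μ hb)]
    refine Finset.sum_congr rfl fun z _ => ?_
    simp only [p, Polynomial.eval_finsetSum, Polynomial.eval_mul, Polynomial.eval_C,
      Polynomial.eval_pow, Polynomial.eval_X, Finset.sum_mul]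
    refine Finset.sum_congr rfl fun b hb => ?_
    rw [Finset.mem_filter] at hb
    have h3 : ((k₀ + t * i : ℕ) : ℂ) ^ m b =
        ((k₀ + t * i : ℕ) : ℂ) ^ L * ((k₀ + t * i : ℕ) : ℂ) ^ ∑ s, b (Sum.inr s) := by
      rw [← zpow_natCast, hm b hb.1, zpow_add₀ hk', zpow_natCast]
    rw [h3, ← hb.2]
    simp only [μ, G]
    rw [pow_add, pow_mul]
    ring)
  ext b
  by_contra hb0
  have hb : b ∈ F.coeff.support := Finsupp.mem_support_iff.2 hb0
  have h4 := congrArg (fun q => Polynomial.coeff q (m b)) (hp (μ b) (Finset.mem_image_of_mem μ hb))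
  simp only [p, Polynomial.finsetSum_coeff, Polynomial.coeff_C_mul, Polynomial.coeff_X_pow,
    Polynomial.coeff_zero] at h4
  rw [Finset.sum_eq_single b] at h4
  · have : F.coeff b = 0 := by simpa using h4
    exact hb0 this
  · intro b' hb' hne
    rw [Finset.mem_filter] at hb'
    rw [if_neg, mul_zero]
    intro hmm
    apply hne
    have h5 : ∑ s, b (Sum.inr s) = ∑ s, b' (Sum.inr s) := by
      have h6 := hm b hb
      rw [hmm, hm b' hb'.1] at h6
      exact (add_left_cancel h6).symm
    ext (j | s)
    · exact hμ _ _ hb'.2 j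
    · obtain rfl : ε = 1 := by have := s.2; omega
      simpa [Subsingleton.elim s 0] using h5.symm
  · intro hn
    refine (hn ?_).elim
    rw [Finset.mem_filter]
    exact ⟨hb, Eq.refl (μ b)⟩

/-! ### Zariski closures -/

section Zariski

variable {σ τ : Type*}

theorem subset_zariskiClosure (S : Set (σ → ℂ)) : S ⊆ zariskiClosure S :=
  zeroLocus_vanishingIdeal_le S

theorem isZariskiClosed_zariskiClosure (S : Set (σ → ℂ)) : IsZariskiClosed (zariskiClosure S) :=
  ⟨_, rfl⟩

theorem zariskiClosure_subset {S V : Set (σ → ℂ)} (hV : IsZariskiClosed V) (h : S ⊆ V) :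
    zariskiClosure S ⊆ V := by
  obtain ⟨I, rfl⟩ := hV
  exact zeroLocus_anti_mono (le_zeroLocus_iff_le_vanishingIdeal.1 h)

theorem zariskiClosure_mono {S T : Set (σ → ℂ)} (h : S ⊆ T) :
    zariskiClosure S ⊆ zariskiClosure T :=
  zeroLocus_anti_mono (vanishingIdeal_anti_mono h)

theorem vanishingIdeal_zariskiClosure (S : Set (σ → ℂ)) :
    vanishingIdeal ℂ (zariskiClosure S) = vanishingIdeal ℂ S :=
  le_antisymm (vanishingIdeal_anti_mono (subset_zariskiClosure S))
    (le_vanishingIdeal_zeroLocus _)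

theorem IsZariskiClosed.empty : IsZariskiClosed (∅ : Set (σ → ℂ)) :=
  ⟨⊤, zeroLocus_top.symm⟩

theorem IsZariskiClosed.union {V W : Set (σ → ℂ)} (hV : IsZariskiClosed V)
    (hW : IsZariskiClosed W) : IsZariskiClosed (V ∪ W) := by
  obtain ⟨I, rfl⟩ := hV
  obtain ⟨J, rfl⟩ := hW
  refine ⟨I * J, Set.Subset.antisymm ?_ ?_⟩
  · exact Set.union_subset (zeroLocus_anti_mono Ideal.mul_le_left)
      (zeroLocus_anti_mono Ideal.mul_le_right)
  · intro x hx
    by_contra h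
    simp only [Set.mem_union, not_or, mem_zeroLocus_iff, not_forall] at h
    obtain ⟨⟨p, hp, hpx⟩, ⟨r, hr, hrx⟩⟩ := h
    have := hx _ (Ideal.mul_mem_mul hp hr)
    rw [map_mul] at this
    exact (mul_ne_zero hpx hrx) this

theorem IsZariskiClosed.iUnion {ι : Type*} [Finite ι] {V : ι → Set (σ → ℂ)}
    (hV : ∀ i, IsZariskiClosed (V i)) : IsZariskiClosed (⋃ i, V i) := by
  rw [← Set.biUnion_univ]
  refine Set.Finite.induction_on (motive := fun s _ => IsZariskiClosed (⋃ i ∈ s, V i)) _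
    Set.finite_univ ?_ ?_
  · simpa using IsZariskiClosed.empty
  · intro i s _ _ ih
    rw [Set.biUnion_insert]
    exact (hV i).union ih

theorem isZariskiClosed_singleton (x : σ → ℂ) : IsZariskiClosed {x} := by
  refine ⟨Ideal.span (Set.range fun i => X i - C (x i)), ?_⟩
  rw [zeroLocus_span]
  ext y
  simp only [Set.mem_singleton_iff, Set.mem_ofPred_eq, Set.forall_mem_range, map_sub, aeval_X,
    aeval_C, Algebra.algebraMap_self, RingHom.id_apply, sub_eq_zero]
  exact _root_.funext_iff

theorem isZariskiClosed_of_finite {S : Set (σ → ℂ)} (hS : S.Finite) : IsZariskiClosed S := by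
  have := hS.to_subtype
  rw [← Set.iUnion_of_singleton_coe S]
  exact IsZariskiClosed.iUnion fun x => isZariskiClosed_singleton _

theorem IsZariskiClosed.zariskiClosure_eq {V : Set (σ → ℂ)} (hV : IsZariskiClosed V) :
    zariskiClosure V = V :=
  (zariskiClosure_subset hV subset_rfl).antisymm (subset_zariskiClosure V)

theorem zariskiClosure_union (S T : Set (σ → ℂ)) :
    zariskiClosure (S ∪ T) = zariskiClosure S ∪ zariskiClosure T := by
  apply Set.Subset.antisymm
  · exact zariskiClosure_subset
      ((isZariskiClosed_zariskiClosure S).union (isZariskiClosed_zariskiClosure T))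
      (Set.union_subset_union (subset_zariskiClosure S) (subset_zariskiClosure T))
  · exact Set.union_subset (zariskiClosure_mono Set.subset_union_left)
      (zariskiClosure_mono Set.subset_union_right)

theorem zariskiClosure_iUnion {ι : Type*} [Finite ι] (S : ι → Set (σ → ℂ)) :
    zariskiClosure (⋃ i, S i) = ⋃ i, zariskiClosure (S i) := by
  apply Set.Subset.antisymm
  · exact zariskiClosure_subset
      (IsZariskiClosed.iUnion fun i => isZariskiClosed_zariskiClosure (S i))
      (Set.iUnion_mono fun i => subset_zariskiClosure (S i))
  · exact Set.iUnion_subset fun i => zariskiClosure_mono (Set.subset_iUnion S i)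

theorem mapsTo_polyMap_zariskiClosure {S : Set (σ → ℂ)} {T : Set (τ → ℂ)}
    {f : τ → MvPolynomial σ ℂ} (h : Set.MapsTo (polyMap f) S T) :
    Set.MapsTo (polyMap f) (zariskiClosure S) (zariskiClosure T) := by
  have hcomp : ∀ (p : MvPolynomial τ ℂ) (x : σ → ℂ),
      aeval (polyMap f x) p = aeval x (bind₁ f p) := by
    intro p x
    rw [aeval_bind₁]
    rfl
  intro x hx p hp
  rw [hcomp]
  apply hx
  intro y hy
  rw [← hcomp]
  exact hp _ (h hy)

theorem leftInvOn_polyMap_zariskiClosure {S : Set (σ → ℂ)} {f : τ → MvPolynomial σ ℂ}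
    {g : σ → MvPolynomial τ ℂ} (h : Set.LeftInvOn (polyMap g) (polyMap f) S) :
    Set.LeftInvOn (polyMap g) (polyMap f) (zariskiClosure S) := by
  intro x hx
  ext s
  have h1 : ∀ y : σ → ℂ, aeval y (bind₁ f (g s) - X s) = polyMap g (polyMap f y) s - y s := by
    intro y
    rw [map_sub, aeval_bind₁, aeval_X]
    rfl
  have h2 : aeval x (bind₁ f (g s) - X s) = 0 := by
    apply hx
    intro y hy
    rw [h1, h hy, sub_self]
  rw [h1] at h2
  exact sub_eq_zero.1 h2

theorem areIsomorphic_zariskiClosure {S : Set (σ → ℂ)} {T : Set (τ → ℂ)}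
    (f : τ → MvPolynomial σ ℂ) (g : σ → MvPolynomial τ ℂ)
    (hf : Set.MapsTo (polyMap f) S T) (hg : Set.MapsTo (polyMap g) T S)
    (hgf : Set.LeftInvOn (polyMap g) (polyMap f) S)
    (hfg : Set.LeftInvOn (polyMap f) (polyMap g) T) :
    AreIsomorphic (zariskiClosure S) (zariskiClosure T) :=
  ⟨f, g, mapsTo_polyMap_zariskiClosure hf, mapsTo_polyMap_zariskiClosure hg,
    leftInvOn_polyMap_zariskiClosure hgf, leftInvOn_polyMap_zariskiClosure hfg⟩

/-- If the vanishing ideal of `S` is the kernel of `Ψ`, then the coordinate ring of the closure is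
the range of `Ψ`. -/
theorem dimension_zariskiClosure {B : Type*} [CommRing B] [Algebra ℂ B] {S : Set (σ → ℂ)}
    (Ψ : MvPolynomial σ ℂ →ₐ[ℂ] B) (h : ∀ F, Ψ F = 0 ↔ F ∈ vanishingIdeal ℂ S) :
    dimension (zariskiClosure S) = ringKrullDim Ψ.range := by
  have hker : vanishingIdeal ℂ (zariskiClosure S) = RingHom.ker Ψ := by
    rw [vanishingIdeal_zariskiClosure]
    ext F
    rw [RingHom.mem_ker, h]
  unfold dimension CoordinateRing
  rw [hker]
  exact ringKrullDim_eq_of_ringEquiv (Ideal.quotientKerEquivRange Ψ).toRingEquiv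

theorem dimension_iUnion {ι : Type*} [Finite ι] [Nonempty ι] {V : ι → Set (σ → ℂ)}
    {d : WithBot ℕ∞} (h : ∀ i, dimension (V i) = d) : dimension (⋃ i, V i) = d := by
  have := Fintype.ofFinite ι
  have hI : vanishingIdeal ℂ (⋃ i, V i) = ⨅ i, vanishingIdeal ℂ (V i) := by
    ext F
    simp only [mem_vanishingIdeal_iff, Set.mem_iUnion, Ideal.mem_iInf]
    exact ⟨fun hF i x hx => hF x ⟨i, hx⟩, fun hF x ⟨i, hx⟩ => hF i x hx⟩
  unfold dimension CoordinateRing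
  rw [hI]
  exact ringKrullDim_quotient_iInf _ h

end Zariski

/-! ### The powers with small exponents -/

section Isolated

variable {n : ℕ} (M : Matrix (Fin n) (Fin n) ℂ)

/-- The matrix `N` is the value at `M` of the minimal polynomial without its factor `X ^ ν`. -/
theorem exists_mul_eq_zero_and_ne_zero :
    ∃ N : Matrix (Fin n) (Fin n) ℂ, M ^ nu M * N = 0 ∧ (0 < nu M → M ^ (nu M - 1) * N ≠ 0) := by
  have hne : minpoly ℂ M ≠ 0 := minpoly.ne_zero (Matrix.isIntegral M)
  obtain ⟨P, hP, -⟩ := Polynomial.exists_eq_pow_rootMultiplicity_mul_and_not_dvd _ hne 0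
  rw [Polynomial.C_0, sub_zero, ← nu_eq_rootMultiplicity] at hP
  refine ⟨Polynomial.aeval M P, ?_, fun hν h => ?_⟩
  · have := minpoly.aeval ℂ M
    rw [hP] at this
    simpa using this
  · have h1 : minpoly ℂ M ∣ Polynomial.X ^ (nu M - 1) * P := by
      rw [minpoly.dvd_iff]
      simpa using h
    have hP0 : P ≠ 0 := by
      rintro rfl
      exact hne (by rw [hP, mul_zero])
    have h2 := Polynomial.natDegree_le_of_dvd h1
      (mul_ne_zero (pow_ne_zero _ Polynomial.X_ne_zero) hP0)
    rw [hP, Polynomial.natDegree_mul (pow_ne_zero _ Polynomial.X_ne_zero) hP0,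
      Polynomial.natDegree_mul (pow_ne_zero _ Polynomial.X_ne_zero) hP0] at h2
    simp at h2
    omega

theorem entries_injective : Function.Injective (entries (n := n)) := by
  intro A B h
  ext i j
  exact congrFun h (i, j)

theorem injOn_entries_pow : Set.InjOn (fun k => entries (M ^ k)) (Set.Icc 1 (nu M)) := by
  obtain ⟨N, hN, hN'⟩ := exists_mul_eq_zero_and_ne_zero M
  have key : ∀ i j, i < j → j ≤ nu M → M ^ i ≠ M ^ j := by
    intro i j hij hj h
    apply hN' (by omega)
    have h1 : M ^ (nu M - 1) = M ^ (j - i - 1) * M ^ nu M := by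
      rw [show nu M - 1 = (nu M - 1 - i) + i by omega, pow_add, h, ← pow_add, ← pow_add]
      congr 1
      omega
    rw [h1, mul_assoc, hN, mul_zero]
  intro i hi j hj h
  have h' : M ^ i = M ^ j := entries_injective h
  rcases lt_trichotomy i j with hlt | heq | hlt
  · exact absurd h' (key i j hlt hj.2)
  · exact heq
  · exact absurd h'.symm (key j i hlt hi.2)

/-- The powers `M ^ k` with `k < ν` are separated from the closure of the later powers by the
linear equation `A * N = 0`. -/
theorem entries_pow_notMem_zariskiClosure {k : ℕ} (hk : k < nu M) {S : Set (Fin n × Fin n → ℂ)}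
    (hS : ∀ x ∈ S, ∃ l, nu M ≤ l ∧ x = entries (M ^ l)) :
    entries (M ^ k) ∉ zariskiClosure S := by
  obtain ⟨N, hN, hN'⟩ := exists_mul_eq_zero_and_ne_zero M
  intro hmem
  have h0 : M ^ k * N = 0 := by
    ext i j
    have h1 := hmem (∑ l, X (i, l) * C (N l j)) (by
      intro x hx
      obtain ⟨l, hl, rfl⟩ := hS x hx
      have h2 : (M ^ l * N) i j = 0 := by
        rw [show l = (l - nu M) + nu M by omega, pow_add, mul_assoc, hN, mul_zero]
        rfl
      simpa [Matrix.mul_apply, entries] using h2)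
    simpa [Matrix.mul_apply, entries] using h1
  apply hN' (by omega)
  rw [show nu M - 1 = (nu M - 1 - k) + k by omega, pow_add, mul_assoc, h0, mul_zero]

end Isolated

/-! ### Toric varieties from dense sequences in the torus -/

theorem evalLaurent_aeval {σ κ : Type} [Fintype κ] (y : κ → ℂˣ) (E : σ → Laurent κ)
    (F : MvPolynomial σ ℂ) :
    evalLaurent y (aeval E F) = aeval (fun p => evalLaurent y (E p)) F := by
  rw [← AlgHom.comp_apply, comp_aeval]

section Toric

variable {σ I κ : Type} [Fintype σ] [Fintype I] [Fintype κ] {K : Type*}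

/-- Points `x k` whose coordinates are linear combinations of Laurent monomials at the points `P k`
of the torus, and conversely. If no nonzero Laurent polynomial vanishes at all `P k`, then the
coordinate ring of the closure of the points `x k` is the algebra generated by the monomials. -/
theorem dimension_zariskiClosure_range (α : I → κ → ℤ)
    (hα : AddSubgroup.closure (Set.range α) = ⊤) (P : K → κ → ℂˣ)
    (hP : ∀ F : Laurent κ, (∀ k, evalLaurent (P k) F = 0) → F = 0) (x : K → σ → ℂ)
    (A : σ → I → ℂ) (A' : I → σ → ℂ)
    (hA : ∀ k p, x k p = ∑ i, A p i * evalLaurent (P k) (laurentMonomial (α i)))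
    (hA' : ∀ k i, evalLaurent (P k) (laurentMonomial (α i)) = ∑ p, A' i p * x k p) :
    dimension (zariskiClosure (Set.range x)) = (Fintype.card κ : WithBot ℕ∞) := by
  let E : σ → Laurent κ := fun p => ∑ i, A p i • laurentMonomial (α i)
  have hE : ∀ k, (fun p => evalLaurent (P k) (E p)) = x k := by
    intro k
    ext p
    rw [hA]
    simp only [E, map_sum, map_smul, smul_eq_mul]
  rw [dimension_zariskiClosure (aeval E), ← ringKrullDim_monomialSubalgebra α hα]
  · have hrange : (aeval E).range = monomialSubalgebra α := by
      rw [← Algebra.adjoin_range_eq_range_aeval]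
      apply le_antisymm
      · rw [Algebra.adjoin_le_iff]
        rintro _ ⟨p, rfl⟩
        exact Subalgebra.sum_mem _ fun i _ =>
          Subalgebra.smul_mem _ (Algebra.subset_adjoin (Set.mem_range_self i)) _
      · rw [Algebra.adjoin_le_iff]
        rintro _ ⟨i, rfl⟩
        have h1 : laurentMonomial (α i) = ∑ p, A' i p • E p := by
          rw [← sub_eq_zero]
          apply hP
          intro k
          rw [map_sub, hA', map_sum, sub_eq_zero]
          refine Finset.sum_congr rfl fun p _ => ?_
          rw [map_smul, smul_eq_mul, ← congrFun (hE k) p]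
        simp only
        rw [h1]
        exact Subalgebra.sum_mem _ fun p _ =>
          Subalgebra.smul_mem _ (Algebra.subset_adjoin (Set.mem_range_self p)) _
    rw [hrange]
  · intro F
    constructor
    · rintro hF _ ⟨k, rfl⟩
      rw [← hE k, ← evalLaurent_aeval, hF, map_zero]
    · intro hF
      apply hP
      intro k
      rw [evalLaurent_aeval, hE]
      exact hF _ ⟨k, rfl⟩

/-- The linear maps `A` and `A'` identify the points `x k` with the values of the monomials at the
points `P k`, which are dense in the toric variety given by `α`. -/
theorem isToricVariety_zariskiClosure_range (α : I → κ → ℤ) (P : K → κ → ℂˣ)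
    (hP : ∀ F : Laurent κ, (∀ k, evalLaurent (P k) F = 0) → F = 0) (x : K → σ → ℂ)
    (A : σ → I → ℂ) (A' : I → σ → ℂ)
    (hA : ∀ k p, x k p = ∑ i, A p i * evalLaurent (P k) (laurentMonomial (α i)))
    (hA' : ∀ k i, evalLaurent (P k) (laurentMonomial (α i)) = ∑ p, A' i p * x k p) :
    IsToricVariety (zariskiClosure (Set.range x)) := by
  let eI := Fintype.equivFin I
  let eκ := Fintype.equivFin κ
  let β : Fin (Fintype.card I) → Fin (Fintype.card κ) → ℤ := fun i j => α (eI.symm i) (eκ.symm j)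
  refine ⟨isZariskiClosed_zariskiClosure _, _, _, β, ?_⟩
  let z : (κ → ℂˣ) → Fin (Fintype.card I) → ℂ :=
    fun y i => evalLaurent y (laurentMonomial (α (eI.symm i)))
  have hz : ∀ y : Fin (Fintype.card κ) → ℂˣ, monomialMap β y = z (y ∘ eκ) := by
    intro y
    ext i
    simp only [monomialMap, z, evalLaurent_monomial, β, Units.coe_prod, Units.val_zpow_eq_zpow_val,
      Function.comp_apply]
    rw [← eκ.prod_comp]
    simp
  -- the sequence `z (P k)` is dense in the toric variety
  have hdense : latticeToricVariety β = zariskiClosure (Set.range fun k => z (P k)) := by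
    have : vanishingIdeal ℂ (Set.range (monomialMap β)) =
        vanishingIdeal ℂ (Set.range fun k => z (P k)) := by
      apply le_antisymm
      · apply vanishingIdeal_anti_mono
        rintro _ ⟨k, rfl⟩
        refine ⟨P k ∘ eκ.symm, ?_⟩
        rw [hz, Function.comp_assoc]
        simp
      · rintro F hF _ ⟨y, rfl⟩
        have h0 : aeval (fun i => laurentMonomial (α (eI.symm i))) F = 0 := by
          apply hP
          intro k
          rw [evalLaurent_aeval]
          exact hF _ ⟨k, rfl⟩
        rw [hz]
        change aeval (fun i => evalLaurent _ _) F = 0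
        rw [← evalLaurent_aeval, h0, map_zero]
    rw [latticeToricVariety, zariskiClosure, this, zariskiClosure]
  rw [hdense]
  let f : Fin (Fintype.card I) → MvPolynomial σ ℂ := fun i => ∑ p, C (A' (eI.symm i) p) * X p
  let g : σ → MvPolynomial (Fin (Fintype.card I)) ℂ := fun p => ∑ i, C (A p (eI.symm i)) * X i
  have hf : ∀ k, polyMap f (x k) = z (P k) := by
    intro k
    ext i
    simp only [polyMap, f, z, hA', map_sum, map_mul, eval_C, eval_X]
  have hg : ∀ k, polyMap g (z (P k)) = x k := by
    intro k
    ext p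
    simp only [polyMap, g, z, map_sum, map_mul, eval_C, eval_X]
    rw [hA, ← eI.symm.sum_comp]
  apply areIsomorphic_zariskiClosure f g
  · rintro _ ⟨k, rfl⟩
    exact ⟨k, (hf k).symm⟩
  · rintro _ ⟨k, rfl⟩
    exact ⟨k, (hg k).symm⟩
  · rintro _ ⟨k, rfl⟩
    rw [hf, hg]
  · rintro _ ⟨k, rfl⟩
    change polyMap f (polyMap g (z (P k))) = z (P k)
    rw [hg, hf]

end Toric

/-! ### The closure of the powers in a residue class -/

section Powers

variable {n : ℕ} (M : Matrix (Fin n) (Fin n) ℂ)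

theorem coe_mem_nonzeroRoots_iff (u : ℂˣ) :
    (u : ℂ) ∈ nonzeroRoots M ↔ u ∈ nonzeroEigenvalues M := by
  have hne : minpoly ℂ M ≠ 0 := minpoly.ne_zero (Matrix.isIntegral M)
  rw [nonzeroRoots, Finset.mem_erase, Multiset.mem_toFinset, Polynomial.mem_roots hne,
    nonzeroEigenvalues, Set.mem_ofPred_eq, Module.End.hasEigenvalue_iff_isRoot,
    Matrix.minpoly_toLin']
  exact and_iff_right u.ne_zero

theorem finite_nonzeroEigenvalues : (nonzeroEigenvalues M).Finite := by
  refine Set.Finite.of_finite_image (f := Units.val) ?_ Units.val_injective.injOn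
  refine (nonzeroRoots M).finite_toSet.subset ?_
  rintro _ ⟨u, hu, rfl⟩
  exact (coe_mem_nonzeroRoots_iff M u).2 hu

/-- The entries of `M ^ k` for `k ≥ max 1 ν` in a residue class modulo the order of the torsion
subgroup of `G(M)`. -/
def powersMod (c : ℕ) : Set (Fin n × Fin n → ℂ) :=
  Set.range fun k : {k : ℕ // max 1 (nu M) ≤ k ∧ k % torsionOrder M = c} => entries (M ^ k.1)

theorem torsionOrder_pos : 0 < torsionOrder M := by
  have : Finite (CommGroup.torsion (eigenvalueGroup M)) :=
    finite_torsion_closure (finite_nonzeroEigenvalues M)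
  exact Nat.card_pos

theorem rootMultiplicity_pos_of_mem_nonzeroRoots {c : ℂ} (hc : c ∈ nonzeroRoots M) :
    0 < (minpoly ℂ M).rootMultiplicity c := by
  have hne : minpoly ℂ M ≠ 0 := minpoly.ne_zero (Matrix.isIntegral M)
  rw [Polynomial.rootMultiplicity_pos hne]
  rw [nonzeroRoots, Finset.mem_erase, Multiset.mem_toFinset, Polynomial.mem_roots hne] at hc
  exact hc.2

/-- For `k` in a fixed residue class, the torsion parts of the eigenvalues contribute constant
factors to `c ^ k * k ^ j`, and what remains is a Laurent monomial in `g ^ k` and `k`. The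
variable `k` is needed exactly if `M ^ max 1 ν` is not diagonalizable. -/
theorem dimension_and_isToricVariety_powersMod {c : ℕ} (hc : c < torsionOrder M) :
    dimension (zariskiClosure (powersMod M c)) = (expectedDim M : WithBot ℕ∞) ∧
      IsToricVariety (zariskiClosure (powersMod M c)) := by
  classical
  have hne : minpoly ℂ M ≠ 0 := minpoly.ne_zero (Matrix.isIntegral M)
  set q := max 1 (nu M) with hq
  set t := torsionOrder M with ht
  have ht0 : 0 < t := torsionOrder_pos M
  obtain ⟨g, a, hg, hτ, ha⟩ := exists_free_coordinates (finite_nonzeroEigenvalues M)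
    (r := groupRank M) rfl
  let ε : ℕ := if IsDiagonalizable (M ^ q) then 0 else 1
  have hε : ε ≤ 1 := by simp only [ε]; split_ifs <;> simp
  have hdim : expectedDim M = groupRank M + ε := by
    simp only [expectedDim, ε]; split_ifs <;> rfl
  have hdiag := isDiagonalizable_pow_iff M (q := q) (by omega)
    (by rw [← nu_eq_rootMultiplicity]; omega)
  obtain ⟨A, A', hAA'⟩ := exists_linear_relations M (q := q)
    (by rw [← nu_eq_rootMultiplicity]; omega)
  let u : ExpIndex M → ℂˣ := fun i => Units.mk0 i.1.1 (Finset.ne_of_mem_erase i.1.2)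
  have hu : ∀ i, u i ∈ nonzeroEigenvalues M := fun i =>
    (coe_mem_nonzeroRoots_iff M _).1 i.1.2
  have hεj : ∀ i : ExpIndex M, ε * (i.2 : ℕ) = i.2 := by
    intro i
    simp only [ε]
    split_ifs with h
    · have := hdiag.1 h _ (Finset.ne_of_mem_erase i.1.2)
      have := i.2.2
      omega
    · simp
  let α : ExpIndex M → Fin (groupRank M) ⊕ Fin ε → ℤ :=
    fun i => Sum.elim (a (u i)) fun _ => (i.2 : ℕ)
  have hα : AddSubgroup.closure (Set.range α) = ⊤ := by
    set H := AddSubgroup.closure (Set.range α)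
    let inl : (Fin (groupRank M) → ℤ) →+ (Fin (groupRank M) ⊕ Fin ε → ℤ) :=
      { toFun := fun v => Sum.elim v 0
        map_zero' := by ext (j | j) <;> rfl
        map_add' := fun v w => by ext (j | j) <;> rfl }
    have hinl : ∀ v, inl v ∈ H := by
      have h1 : AddSubgroup.closure (a '' nonzeroEigenvalues M) ≤ H.comap inl := by
        rw [AddSubgroup.closure_le]
        rintro _ ⟨w, hw, rfl⟩
        have hw' := (coe_mem_nonzeroRoots_iff M w).2 hw
        have hm : α ⟨⟨w, hw'⟩, ⟨0, rootMultiplicity_pos_of_mem_nonzeroRoots M hw'⟩⟩ =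
            inl (a w) := by
          have : u ⟨⟨w, hw'⟩, ⟨0, rootMultiplicity_pos_of_mem_nonzeroRoots M hw'⟩⟩ = w :=
            Units.ext rfl
          ext (j | j)
          · simp only [α, this]
            rfl
          · rfl
        change inl (a w) ∈ H
        rw [← hm]
        exact AddSubgroup.subset_closure (Set.mem_range_self _)
      intro v
      exact h1 (ha ▸ AddSubgroup.mem_top v)
    have hinr : ∀ j, Pi.single (Sum.inr j) 1 ∈ H := by
      intro j
      have hnd : ¬ IsDiagonalizable (M ^ q) := fun h => by
        have := j.2
        simp [ε, h] at this
      rw [hdiag] at hnd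
      push Not at hnd
      obtain ⟨w, hw0, hw⟩ := hnd
      have hw' : w ∈ nonzeroRoots M := by
        rw [nonzeroRoots, Finset.mem_erase, Multiset.mem_toFinset, Polynomial.mem_roots hne,
          ← Polynomial.rootMultiplicity_pos hne]
        exact ⟨hw0, by omega⟩
      have hw1 : 0 < (minpoly ℂ M).rootMultiplicity w := by omega
      -- the exponents belonging to `w ^ k * k` and `w ^ k` differ by the last unit vector
      have hsub : Pi.single (Sum.inr j) 1 = α ⟨⟨w, hw'⟩, ⟨1, hw⟩⟩ - α ⟨⟨w, hw'⟩, ⟨0, hw1⟩⟩ := by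
        ext (i | i)
        · simp [α, u]
        · have : i = j := by ext; have := i.2; have := j.2; omega
          simp [α, this]
      rw [hsub]
      exact H.sub_mem (AddSubgroup.subset_closure (Set.mem_range_self _))
        (AddSubgroup.subset_closure (Set.mem_range_self _))
    rw [eq_top_iff]
    intro v _
    have hv : v = inl (fun j => v (Sum.inl j)) +
        ∑ j, v (Sum.inr j) • Pi.single (Sum.inr j) (1 : ℤ) := by
      ext (i | i)
      · simp [inl, Finset.sum_apply]
      · simp [inl, Finset.sum_apply, Pi.single_apply]
    rw [hv]
    exact H.add_mem (hinl _) (H.sum_mem fun j _ => H.zsmul_mem (hinr j) _)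
  let s : ExpIndex M → ℂˣ := fun i => (u i * (∏ j, g j ^ a (u i) j)⁻¹) ^ c
  have hs : ∀ (k : ℕ) (i : ExpIndex M), 0 < k → k % t = c →
      i.1.1 ^ k * (k : ℂ) ^ (i.2 : ℕ) =
        s i * evalLaurent (expPoint g k) (laurentMonomial (α i)) := by
    intro k i hk hkc
    rw [evalLaurent_monomial, expPoint_prod g hk]
    have h1 : (u i * (∏ j, g j ^ a (u i) j)⁻¹) ^ k = s i := by
      simp only [s]
      rw [← hkc]
      exact pow_eq_pow_mod k (hτ _ (hu i))
    rw [← h1]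
    simp only [α, Sum.elim_inl, Sum.elim_inr, Finset.sum_const, Finset.card_univ,
      Fintype.card_fin, nsmul_eq_mul]
    rw [← Nat.cast_mul, hεj, zpow_natCast, ← mul_assoc, Units.val_pow_eq_pow_val, ← mul_pow,
      ← Units.val_mul, inv_mul_cancel_right]
    rfl
  let P : {k : ℕ // q ≤ k ∧ k % t = c} → Fin (groupRank M) ⊕ Fin ε → ℂˣ :=
    fun k => expPoint g k.1
  have hP : ∀ F : Laurent (Fin (groupRank M) ⊕ Fin ε), (∀ k, evalLaurent (P k) F = 0) → F = 0 := by
    intro F hF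
    refine laurent_eq_zero hε g hg (c + t * q) t ?_ ht0 F fun i => ?_
    · have : 0 < t * q := Nat.mul_pos ht0 (by omega)
      omega
    · refine hF ⟨c + t * q + t * i, ?_, ?_⟩
      · have : q ≤ t * q := Nat.le_mul_of_pos_left _ ht0
        omega
      · rw [Nat.add_mul_mod_self_left, Nat.add_mul_mod_self_left, Nat.mod_eq_of_lt hc]
  have hA : ∀ (k : {k : ℕ // q ≤ k ∧ k % t = c}) p, entries (M ^ k.1) p =
      ∑ i, A p i * s i * evalLaurent (P k) (laurentMonomial (α i)) := by
    rintro ⟨k, hk, hkc⟩ p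
    rw [(hAA' k hk).1 p]
    refine Finset.sum_congr rfl fun i _ => ?_
    rw [hs k i (by omega) hkc, mul_assoc]
  have hA' : ∀ (k : {k : ℕ // q ≤ k ∧ k % t = c}) i,
      evalLaurent (P k) (laurentMonomial (α i)) =
        ∑ p, (((s i)⁻¹ : ℂˣ) : ℂ) * A' i p * entries (M ^ k.1) p := by
    rintro ⟨k, hk, hkc⟩ i
    have h1 := (hAA' k hk).2 i
    rw [hs k i (by omega) hkc] at h1
    simp only [mul_assoc]
    rw [← Finset.mul_sum, ← h1, ← mul_assoc, Units.inv_mul, one_mul]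
  constructor
  · have := dimension_zariskiClosure_range α hα P hP (fun k => entries (M ^ k.1)) _ _ hA hA'
    rw [hdim, powersMod]
    simpa using this
  · exact isToricVariety_zariskiClosure_range α P hP (fun k => entries (M ^ k.1)) _ _ hA hA'

end Powers

/-! ### Distinct residue classes have distinct closures -/

section Distinct

variable {n : ℕ} (M : Matrix (Fin n) (Fin n) ℂ)

/-- The powers of an element of `G(M)` are rational functions of the entries of `M ^ k`. -/
theorem exists_eval_eq_pow_mul_eval {w : ℂˣ} (hw : w ∈ eigenvalueGroup M) :
    ∃ F H : MvPolynomial (Fin n × Fin n) ℂ, ∀ k, max 1 (nu M) ≤ k →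
      aeval (entries (M ^ k)) H ≠ 0 ∧
        aeval (entries (M ^ k)) F = (w : ℂ) ^ k * aeval (entries (M ^ k)) H := by
  obtain ⟨A, A', hAA'⟩ := exists_linear_relations M (q := max 1 (nu M))
    (by rw [← nu_eq_rootMultiplicity]; omega)
  induction hw using Subgroup.closure_induction with
  | mem w hw =>
    have hw' := (coe_mem_nonzeroRoots_iff M w).2 hw
    let i : ExpIndex M := ⟨⟨w, hw'⟩, ⟨0, rootMultiplicity_pos_of_mem_nonzeroRoots M hw'⟩⟩
    refine ⟨∑ p, C (A' i p) * X p, 1, fun k hk => ⟨by simp, ?_⟩⟩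
    have h := (hAA' k hk).2 i
    simp only [i, pow_zero, mul_one] at h
    rw [h]
    simp [i]
  | one => exact ⟨1, 1, fun k _ => by simp⟩
  | mul v w _ _ hv hw =>
    obtain ⟨F, H, h⟩ := hv
    obtain ⟨F', H', h'⟩ := hw
    refine ⟨F * F', H * H', fun k hk => ⟨?_, ?_⟩⟩
    · rw [map_mul]
      exact mul_ne_zero (h k hk).1 (h' k hk).1
    · rw [map_mul, map_mul, (h k hk).2, (h' k hk).2, Units.val_mul, mul_pow]
      ring
  | inv w _ hw =>
    obtain ⟨F, H, h⟩ := hw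
    have hwk : ∀ k, (w : ℂ) ^ k ≠ 0 := fun k => pow_ne_zero _ w.ne_zero
    refine ⟨H, F, fun k hk => ⟨?_, ?_⟩⟩
    · rw [(h k hk).2]
      exact mul_ne_zero (hwk k) (h k hk).1
    · rw [(h k hk).2, Units.val_inv_eq_inv_val, inv_pow, inv_mul_cancel_left₀ (hwk k)]

/-- The root of unity `ζ` of maximal order in `G(M)` separates the residue classes, since `ζ ^ k`
is a rational function of the entries of `M ^ k`. -/
theorem injective_zariskiClosure_powersMod :
    Function.Injective fun c : Fin (torsionOrder M) => zariskiClosure (powersMod M c) := by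
  intro c d hcd
  simp only at hcd
  obtain ⟨ζ, hζ, hord⟩ := exists_orderOf_eq_card_torsion (finite_nonzeroEigenvalues M)
  change orderOf ζ = torsionOrder M at hord
  obtain ⟨F, H, hFH⟩ := exists_eval_eq_pow_mul_eval M hζ
  have hmem : F - C ((ζ : ℂ) ^ (c : ℕ)) * H ∈ vanishingIdeal ℂ (powersMod M c) := by
    rintro _ ⟨⟨k, hk, hkc⟩, rfl⟩
    have hζk : ζ ^ k = ζ ^ (c : ℕ) := by
      rw [← hkc, ← hord, pow_mod_orderOf]
    simp only [map_sub, map_mul, aeval_C, (hFH k hk).2]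
    rw [← Units.val_pow_eq_pow_val, hζk]
    simp
  rw [← vanishingIdeal_zariskiClosure, hcd, vanishingIdeal_zariskiClosure] at hmem
  have ht := torsionOrder_pos M
  set q := max 1 (nu M)
  have hk : q ≤ d + torsionOrder M * q :=
    (Nat.le_mul_of_pos_left _ ht).trans (Nat.le_add_left _ _)
  have hkd : (d + torsionOrder M * q) % torsionOrder M = d := by
    rw [Nat.add_mul_mod_self_left, Nat.mod_eq_of_lt d.2]
  have h0 := hmem _ ⟨⟨_, hk, hkd⟩, rfl⟩
  simp only [map_sub, map_mul, aeval_C, (hFH _ hk).2, ← sub_mul] at h0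
  have h1 := (mul_eq_zero.1 h0).resolve_right (hFH _ hk).1
  have h2 : ζ ^ (d + torsionOrder M * q) = ζ ^ (c : ℕ) := by
    apply Units.ext
    rw [Units.val_pow_eq_pow_val, Units.val_pow_eq_pow_val]
    exact sub_eq_zero.1 h1
  rw [← pow_mod_orderOf, hord, hkd] at h2
  exact Fin.ext (pow_injOn_Iio_orderOf (by simp [hord]) (by simp [hord]) h2.symm)

end Distinct

/-! ### The closure of the semigroup -/

section Semigroup

variable {n : ℕ} (M : Matrix (Fin n) (Fin n) ℂ)

theorem semigroupSet_eq :
    semigroupSet M = (fun k => entries (M ^ k)) '' Set.Ico 1 (nu M) ∪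
      ⋃ c : Fin (torsionOrder M), powersMod M c := by
  ext x
  simp only [semigroupSet, Set.mem_ofPred_eq, Set.mem_union, Set.mem_image, Set.mem_Ico,
    Set.mem_iUnion, powersMod, Set.mem_range, Subtype.exists]
  constructor
  · rintro ⟨k, hk, rfl⟩
    rcases lt_or_ge k (nu M) with h | h
    · exact Or.inl ⟨k, ⟨hk, h⟩, rfl⟩
    · exact Or.inr ⟨⟨_, Nat.mod_lt k (torsionOrder_pos M)⟩, k, ⟨by omega, rfl⟩, rfl⟩
  · rintro (⟨k, ⟨hk, -⟩, rfl⟩ | ⟨c, k, ⟨hk, -⟩, rfl⟩)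
    · exact ⟨k, hk, rfl⟩
    · exact ⟨k, by omega, rfl⟩

/-- Without nonzero eigenvalues `M` is nilpotent. -/
theorem pow_nu_eq_zero (h : nonzeroEigenvalues M = ∅) : M ^ nu M = 0 := by
  have hmon : (minpoly ℂ M).Monic := minpoly.monic (Matrix.isIntegral M)
  have hroots : (minpoly ℂ M).roots = Multiset.replicate (minpoly ℂ M).roots.card 0 := by
    rw [Multiset.eq_replicate_card]
    intro c hc
    by_contra hc0
    have : (Units.mk0 c hc0) ∈ nonzeroEigenvalues M := by
      rw [← coe_mem_nonzeroRoots_iff, nonzeroRoots, Finset.mem_erase, Multiset.mem_toFinset]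
      exact ⟨hc0, hc⟩
    rw [h] at this
    exact this
  have hX : minpoly ℂ M = Polynomial.X ^ (minpoly ℂ M).roots.card := by
    conv_lhs => rw [(IsAlgClosed.splits (minpoly ℂ M)).eq_prod_roots_of_monic hmon, hroots]
    simp
  have hν : nu M = (minpoly ℂ M).roots.card := by
    rw [nu_eq_rootMultiplicity, ← Polynomial.count_roots]
    conv_lhs => rw [hroots]
    simp
  have h0 := minpoly.aeval ℂ M
  rw [hX, map_pow, Polynomial.aeval_X, ← hν] at h0
  exact h0

theorem semigroupSet_eq_of_nonzeroEigenvalues_eq_empty (hM : M ≠ 0)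
    (h : nonzeroEigenvalues M = ∅) :
    semigroupSet M = (fun k => entries (M ^ k)) '' Set.Icc 1 (nu M) := by
  have h0 := pow_nu_eq_zero M h
  have hν : 1 ≤ nu M := by
    by_contra hν
    rw [show nu M = 0 by omega, pow_zero] at h0
    exact hM (by rw [← mul_one M, h0, mul_zero])
  ext x
  constructor
  · rintro ⟨k, hk, rfl⟩
    rcases le_total k (nu M) with hkν | hkν
    · exact ⟨k, ⟨hk, hkν⟩, rfl⟩
    · refine ⟨nu M, ⟨hν, le_rfl⟩, ?_⟩
      simp only [h0, pow_eq_zero_of_le hkν h0]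
  · rintro ⟨k, ⟨hk, -⟩, rfl⟩
    exact ⟨k, hk, rfl⟩

end Semigroup

end CyclicClosure

theorem mainTheorem1 (n : ℕ) (M : Matrix (Fin n) (Fin n) ℂ) (hM : M ≠ 0) :
    ∃ X₀ X₁ : Set (Fin n × Fin n → ℂ),
      CyclicClosure.IsZariskiClosed X₀ ∧ CyclicClosure.IsZariskiClosed X₁ ∧
      CyclicClosure.zariskiClosure (CyclicClosure.semigroupSet M) = X₀ ∪ X₁ ∧
      Disjoint X₀ X₁ ∧
      X₀.Finite ∧
      (CyclicClosure.nonzeroEigenvalues M = ∅ →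
        X₀.ncard = CyclicClosure.nu M ∧ X₁ = ∅) ∧
      (CyclicClosure.nonzeroEigenvalues M ≠ ∅ →
        (X₀.ncard : ℤ) = max 0 ((CyclicClosure.nu M : ℤ) - 1) ∧
        CyclicClosure.dimension X₁ = (CyclicClosure.expectedDim M : WithBot ℕ∞) ∧
        ∃ Y : Fin (CyclicClosure.torsionOrder M) → Set (Fin n × Fin n → ℂ),
          Function.Injective Y ∧
          X₁ = ⋃ i, Y i ∧
          ∀ i, CyclicClosure.IsToricVariety (Y i) ∧
            CyclicClosure.dimension (Y i) = (CyclicClosure.expectedDim M : WithBot ℕ∞)) := by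
  open CyclicClosure in
  by_cases hE : nonzeroEigenvalues M = ∅
  · have hfin : ((fun k => entries (M ^ k)) '' Set.Icc 1 (nu M)).Finite :=
      (Set.finite_Icc 1 (nu M)).image _
    refine ⟨(fun k => entries (M ^ k)) '' Set.Icc 1 (nu M), ∅, isZariskiClosed_of_finite hfin,
      IsZariskiClosed.empty, ?_, Set.disjoint_empty _, hfin, fun _ => ⟨?_, rfl⟩,
      fun h => absurd hE h⟩
    · rw [semigroupSet_eq_of_nonzeroEigenvalues_eq_empty M hM hE, Set.union_empty,
        (isZariskiClosed_of_finite hfin).zariskiClosure_eq]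
    · rw [(injOn_entries_pow M).ncard_image, Set.ncard_eq_toFinset_card']
      simp
  · have hfin : ((fun k => entries (M ^ k)) '' Set.Ico 1 (nu M)).Finite :=
      (Set.finite_Ico 1 (nu M)).image _
    have : Nonempty (Fin (torsionOrder M)) := ⟨⟨0, torsionOrder_pos M⟩⟩
    refine ⟨(fun k => entries (M ^ k)) '' Set.Ico 1 (nu M),
      ⋃ c : Fin (torsionOrder M), zariskiClosure (powersMod M c), isZariskiClosed_of_finite hfin,
      IsZariskiClosed.iUnion fun c => isZariskiClosed_zariskiClosure _, ?_, ?_, hfin,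
      fun h => absurd h hE, fun _ => ⟨?_, ?_, ?_⟩⟩
    · rw [semigroupSet_eq, zariskiClosure_union, zariskiClosure_iUnion,
        (isZariskiClosed_of_finite hfin).zariskiClosure_eq]
    · rw [Set.disjoint_left]
      rintro _ ⟨k, hk, rfl⟩ hmem
      obtain ⟨c, hc⟩ := Set.mem_iUnion.1 hmem
      refine entries_pow_notMem_zariskiClosure M hk.2 ?_ hc
      rintro _ ⟨⟨l, hl, -⟩, rfl⟩
      exact ⟨l, (le_max_right _ _).trans hl, rfl⟩
    · rw [((injOn_entries_pow M).mono Set.Ico_subset_Icc_self).ncard_image,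
        Set.ncard_eq_toFinset_card']
      simp only [Set.toFinset_Ico, Nat.card_Ico]
      omega
    · exact dimension_iUnion fun c => (dimension_and_isToricVariety_powersMod M c.2).1
    · exact ⟨fun c => zariskiClosure (powersMod M c), injective_zariskiClosure_powersMod M, rfl,
        fun c => ⟨(dimension_and_isToricVariety_powersMod M c.2).2,
          (dimension_and_isToricVariety_powersMod M c.2).1⟩⟩
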